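/- For integers $r\ge 1$, $m\ge 0$ let $\mathrm{RM}(r,m)\subseteq\mathbb F_2^{2^m}$ be the binary Reed–Muller code, i.e. the set of evaluation vectors $(f(a))_{a\in\mathbb F_2^m}$ of the polynomials $f\in\mathbb F_2[x_1,\dots,x_m]$ of degree at most $r$, and let $k=\dim \mathrm{RM}(r,m)$. For $n\ge 1$ let $\mathcal E=\mathcal E(\mathrm{RM}(r,m))$ be the random code of length $n$ obtained by drawing $t_1,\dots,t_n\in\mathbb F_2^m$ independently and uniformly (with replacement) and setting $\mathcal E=\{(x_{t_1},\dots,x_{t_n}) : x\in\mathrm{RM}(r,m)\}$, regarded as a multiset with $2^k$ elements, so that its rate is $k/n$. A code $\mathcal C$ of length $n$ is $(\rho,L)$-list decodable if for every $w\in\mathbb F_2^n$ at most $L$ elements $c$ of $\mathcal C$ (counted with multiplicity) satisfy $\frac1n|\{i : c_i\ne w_i\}|\le\rho$. **Proposition.** There is an absolute constant $c>0$ such that for every integer $r\ge1$ there are a constant $K_r\in\mathbb N$ and a function $\delta_r:\mathbb N\to\mathbb R$ with $\delta_r(m)\to0$ as $m\to\infty$, for which the following holds. For all $m\ge0$, $0<\varepsilon<1$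 and $n\ge1$ with rate $k/n\le c\,\varepsilon^2$, the code $\mathcal E(\mathrm{RM}(r,m))$ is $\bigl(\tfrac12(1-\varepsilon),L(\varepsilon)\bigr)$-list decodable with probability at least $1-\delta_r(m)$, where $$L(\varepsilon)=\left(\frac1\varepsilon\right)^{K_r\,m^{r-1}}.$$ -/

import Mathlib

open Filter Topology

noncomputable section

/-- The binary Reed-Muller code `RM(r,m)`: the words, indexed by the points of `𝔽₂^m`, obtained
by evaluating the `m`-variate polynomials over `𝔽₂` of total degree at most `r`. -/
def reedMuller (r m : ℕ) : Submodule (ZMod 2) ((Fin m → ZMod 2) → ZMod 2) :=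
  (MvPolynomial.restrictTotalDegree (Fin m) (ZMod 2) r).map
    (MvPolynomial.evalₗ (ZMod 2) (Fin m))

/-- The relative Hamming distance of two words of length `n`. -/
def relDist {α : Type*} [DecidableEq α] {n : ℕ} (x y : Fin n → α) : ℝ :=
  (hammingDist x y : ℝ) / n

open Classical in
/-- A code of length `n`, given as a multiset of words, is `(ρ, L)`-list decodable if every word
has at most `L` codewords (counted with multiplicity) within relative distance `ρ`. -/
def IsListDecodable {α : Type*} {n : ℕ} (C : Multiset (Fin n → α)) (ρ L : ℝ) : Prop :=
  ∀ w : Fin n → α, ((C.filter fun c => relDist c w ≤ ρ).card : ℝ) ≤ L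

/-- The code obtained from a code `C` with coordinates indexed by `ι` by sampling the coordinates
`t 0, …, t (n - 1)`. It is the multiset of the words `(x (t 0), …, x (t (n - 1)))`, `x ∈ C`, so
that its cardinality is always that of `C`. -/
def sampledCode {ι α : Type*} [Finite ι] [Finite α] (C : Set (ι → α)) {n : ℕ}
    (t : Fin n → ι) : Multiset (Fin n → α) :=
  C.toFinite.toFinset.val.map fun x => x ∘ t

open Classical in
/-- The probability that the property `p` holds for a uniformly random element of the finite
type `Ω`. For `Ω = (Fin n → ι)` such an element consists of `n` independent uniform draws from
`ι`, with replacement. -/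
def uniformProb {Ω : Type*} [Fintype Ω] (p : Ω → Prop) : ℝ :=
  ((Finset.univ.filter p).card : ℝ) / Fintype.card Ω

end

/-! ### Reed-Muller codes -/

section ReedMuller

variable {r m : ℕ}

/-! Let `s` be the set of codewords whose samples lie within `(1 - ε)/2` of a word `w`, and let `F`
be the average of the sign functions `(-1)^f`, `f ∈ s`. On the sample, `F` has correlation at least
`ε` with the signs of `w`, so the empirical mean of `|F|` is at least `ε`. If empirical means of
such averages exceed the true means by less than `ε/2`, for all families at once, then `F` has `L¹`
norm at least `ε/2` on the whole cube. Its second moment is the average bias of the differences `f -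
g`, so many differences are biased; since a Reed-Muller code has few biased words, `s` is small
(`card_le_of_mean_abs_avgFun_ge`).

Uniformity (`card_deviation_le`): there are doubly exponentially many families, but symmetrization
and contraction remove the absolute value, and then Jensen bounds the exponential of an average by a
sum over single codewords. The union bound costs only `2^k`, so `n` of order `k/ε²` suffices.

Biased words (`card_biased_le`): the sign sum of a biased `f` over a random affine subspace through
`x` determines `f x` for most `x`, and derivatives in few directions then determine `f`. Derivatives
have degree one less, which produces the exponent `m^(r-1)`.

This gives a list bound `(C/ε^6)^(O(m^(r-1)))`, whose constant `C` cannot be absorbed when `ε` is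
close to 1. There the minimum distance of the sampled code helps (`card_small_wt_le`): a list with
two words forces `ε < 1 - d` for a fixed `d > 0`, so `C` is at most a power of `1/ε`. -/

theorem mem_reedMuller_iff {f : (Fin m → ZMod 2) → ZMod 2} :
    f ∈ reedMuller r m ↔ ∃ p : MvPolynomial (Fin m) (ZMod 2), p.totalDegree ≤ r ∧
      ∀ x, MvPolynomial.eval x p = f x := by
  simp only [reedMuller, Submodule.mem_map, MvPolynomial.mem_restrictTotalDegree, funext_iff,
    MvPolynomial.evalₗ_apply]

theorem coord_mul_mem_reedMuller (i : Fin m) {f : (Fin m → ZMod 2) → ZMod 2}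
    (hf : f ∈ reedMuller r m) : (fun x => x i * f x) ∈ reedMuller (r + 1) m := by
  obtain ⟨p, hp, hpf⟩ := mem_reedMuller_iff.1 hf
  refine mem_reedMuller_iff.2 ⟨MvPolynomial.X i * p, ?_, by simp [hpf]⟩
  refine (MvPolynomial.totalDegree_mul _ _).trans ?_
  rw [MvPolynomial.totalDegree_X]
  omega

theorem exists_eq_const_of_mem_reedMuller_zero {f : (Fin m → ZMod 2) → ZMod 2}
    (hf : f ∈ reedMuller 0 m) : ∃ c, ∀ x, f x = c := by
  obtain ⟨p, hp, hpf⟩ := mem_reedMuller_iff.1 hf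
  have hp0 : p.totalDegree = 0 := by omega
  rw [MvPolynomial.totalDegree_eq_zero_iff_eq_C] at hp0
  refine ⟨MvPolynomial.coeff 0 p, fun x => ?_⟩
  rw [← hpf x, hp0]
  simp

/-- The monomial function with exponents `s`. -/
noncomputable def monomialFun (s : Fin m →₀ ℕ) (x : Fin m → ZMod 2) : ZMod 2 :=
  MvPolynomial.eval x (MvPolynomial.monomial s (1 : ZMod 2))

theorem monomialFun_mem_reedMuller (s : Fin m →₀ ℕ) (h : s.degree ≤ r) :
    monomialFun s ∈ reedMuller r m := by
  refine mem_reedMuller_iff.2 ⟨MvPolynomial.monomial s 1, ?_, fun x => rfl⟩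
  rw [MvPolynomial.totalDegree_monomial _ one_ne_zero]
  exact h

theorem monomialFun_single_add (i : Fin m) (s : Fin m →₀ ℕ) (x : Fin m → ZMod 2) :
    monomialFun (Finsupp.single i 1 + s) x = x i * monomialFun s x := by
  simp only [monomialFun]
  rw [← mul_one (1 : ZMod 2), ← MvPolynomial.monomial_mul, map_mul, mul_one]
  congr 1
  simp [MvPolynomial.eval_monomial]

/-- Splitting off one variable, the product rule reads `D(x_i g) = x_i · D g + a_i (D g + g)`. The
hypothesis is `d ≤ r + 1` rather than equality so that the induction hypothesis can be used both at
`r` and at `r - 1`. -/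
theorem fwdDiff_monomialFun_mem (a : Fin m → ZMod 2) (d : ℕ) :
    ∀ (r : ℕ) (s : Fin m →₀ ℕ), s.degree = d → d ≤ r + 1 →
      fwdDiff a (monomialFun s) ∈ reedMuller r m := by
  induction d with
  | zero =>
    intro r s hs _
    have : s = 0 := (Finsupp.degree_eq_zero_iff s).1 hs
    subst this
    have : fwdDiff a (monomialFun (0 : Fin m →₀ ℕ)) = 0 := by
      funext x
      simp [fwdDiff, monomialFun]
    rw [this]
    exact zero_mem _
  | succ d ih =>
    intro r s hs hr
    obtain ⟨i, hi⟩ : ∃ i, s i ≠ 0 := by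
      by_contra! h
      have : s = 0 := by ext i; simp [h i]
      simp [this] at hs
    have hle : Finsupp.single i 1 ≤ s := by
      rw [Finsupp.single_le_iff]; omega
    obtain ⟨s', rfl⟩ := exists_add_of_le hle
    have hs' : s'.degree = d := by
      rw [map_add, Finsupp.degree_single] at hs
      omega
    have key : fwdDiff a (monomialFun (Finsupp.single i 1 + s')) =
        (fun x => x i * fwdDiff a (monomialFun s') x) +
          a i • (fwdDiff a (monomialFun s') + monomialFun s') := by
      funext x
      simp only [fwdDiff, monomialFun_single_add, Pi.add_apply, Pi.smul_apply, smul_eq_mul]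
      ring
    have hm : monomialFun s' ∈ reedMuller r m := monomialFun_mem_reedMuller s' (by omega)
    rw [key]
    refine add_mem ?_ (Submodule.smul_mem _ _ (add_mem (ih r s' hs' (by omega)) hm))
    -- For `r = 0` there is no smaller degree to use, but then `g` is constant and `x_i · D g`
    -- vanishes.
    rcases r with _ | r
    · have : s' = 0 := by
        have : d = 0 := by omega
        subst this
        exact (Finsupp.degree_eq_zero_iff s').1 hs'
      subst this
      convert zero_mem (reedMuller 0 m) using 1
      funext x
      simp [fwdDiff, monomialFun]
    · exact coord_mul_mem_reedMuller i (ih r s' hs' (by omega))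

/-- Discrete derivatives lower the degree. -/
theorem fwdDiff_mem_reedMuller (a : Fin m → ZMod 2) {f : (Fin m → ZMod 2) → ZMod 2}
    (hf : f ∈ reedMuller (r + 1) m) : fwdDiff a f ∈ reedMuller r m := by
  obtain ⟨p, hp, hpf⟩ := mem_reedMuller_iff.1 hf
  have hfe : f = ∑ s ∈ p.support, p.coeff s • monomialFun s := by
    funext x
    rw [← hpf x, Finset.sum_apply]
    conv_lhs => rw [p.as_sum, map_sum]
    refine Finset.sum_congr rfl fun s _ => ?_
    simp [monomialFun, MvPolynomial.eval_monomial]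
  rw [hfe, fwdDiff_finsetSum]
  refine sum_mem fun s hs => ?_
  rw [fwdDiff_const_smul]
  refine Submodule.smul_mem _ _ (fwdDiff_monomialFun_mem a s.degree r s rfl ?_)
  exact (MvPolynomial.le_totalDegree hs).trans hp

open Classical in
/-- The Hamming weight of a word. -/
def wt {T : Type*} [Fintype T] (f : T → ZMod 2) : ℕ := (Finset.univ.filter fun x => f x ≠ 0).card

theorem wt_fwdDiff_le (a : Fin m → ZMod 2) (f : (Fin m → ZMod 2) → ZMod 2) :
    wt (fwdDiff a f) ≤ 2 * wt f := by
  classical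
  have h1 : (Finset.univ.filter fun x => fwdDiff a f x ≠ 0) ⊆
      (Finset.univ.filter fun x => f (x + a) ≠ 0) ∪ (Finset.univ.filter fun x => f x ≠ 0) := by
    intro x
    simp only [Finset.mem_filter, Finset.mem_univ, true_and, Finset.mem_union]
    intro h
    by_contra! h'
    simp [fwdDiff, h'] at h
  have h2 : (Finset.univ.filter fun x => f (x + a) ≠ 0).card =
      (Finset.univ.filter fun x => f x ≠ 0).card :=
    Finset.card_equiv (Equiv.addRight a) (by simp)
  have h3 := (Finset.card_le_card h1).trans (Finset.card_union_le _ _)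
  rw [h2, ← two_mul] at h3
  exact h3

/-- The minimum distance of the Reed-Muller code. -/
theorem card_le_two_pow_mul_wt (r : ℕ) :
    ∀ {f : (Fin m → ZMod 2) → ZMod 2}, f ∈ reedMuller r m → f ≠ 0 →
      Fintype.card (Fin m → ZMod 2) ≤ 2 ^ r * wt f := by
  have hconst : ∀ {f : (Fin m → ZMod 2) → ZMod 2} {c : ZMod 2}, (∀ x, f x = c) → f ≠ 0 →
      wt f = Fintype.card (Fin m → ZMod 2) := by
    intro f c hc hf
    have hc0 : c ≠ 0 := fun h => hf (funext fun x => by simp [hc, h])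
    rw [wt, Finset.filter_true_of_mem fun x _ => by rw [hc]; exact hc0, Finset.card_univ]
  induction r with
  | zero =>
    intro f hf hf0
    obtain ⟨c, hc⟩ := exists_eq_const_of_mem_reedMuller_zero hf
    rw [hconst hc hf0]
    simp
  | succ r ih =>
    intro f hf hf0
    -- Either `f` is constant, or some derivative is nonzero, lies in the code of lower degree, and
    -- has at most twice the weight.
    by_cases h : ∀ a, fwdDiff a f = 0
    · have hc : ∀ x, f x = f 0 := fun x => by
        have := congrFun (h x) 0
        simp only [fwdDiff, zero_add, Pi.zero_apply] at this
        exact sub_eq_zero.1 this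
      rw [hconst hc hf0]
      exact Nat.le_mul_of_pos_left _ (by positivity)
    · push Not at h
      obtain ⟨a, ha⟩ := h
      calc _ ≤ 2 ^ r * wt (fwdDiff a f) := ih (fwdDiff_mem_reedMuller a hf) ha
        _ ≤ 2 ^ r * (2 * wt f) := Nat.mul_le_mul_left _ (wt_fwdDiff_le a f)
        _ = _ := by ring

/-! ### Size and dimension of Reed-Muller codes. -/

theorem natCard_reedMuller (r m : ℕ) :
    Nat.card (reedMuller r m) = 2 ^ Module.finrank (ZMod 2) (reedMuller r m) := by
  rw [Module.natCard_eq_pow_finrank (K := ZMod 2)]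
  simp

theorem eq_of_fwdDiff_single_eq_zero {f : (Fin m → ZMod 2) → ZMod 2}
    (h : ∀ i, fwdDiff (Pi.single i 1) f = 0) (x : Fin m → ZMod 2) : f x = f 0 := by
  have hper : ∀ i (c : ZMod 2) y, f (y + Pi.single i c) = f y := by
    intro i c y
    rcases (by decide +revert : c = 0 ∨ c = 1) with rfl | rfl
    · simp
    · exact sub_eq_zero.1 (congrFun (h i) y)
  have hsum : ∀ s : Finset (Fin m), f (∑ i ∈ s, Pi.single i (x i)) = f 0 := by
    intro s
    induction s using Finset.induction_on with
    | empty => simp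
    | insert i s hi ih => rw [Finset.sum_insert hi, add_comm, hper, ih]
  rw [← hsum Finset.univ, Finset.univ_sum_single]

/-- A word is determined by its value at 0 and its `m` derivatives along the coordinate directions,
so raising the degree by one turns the size `q` into at most `2 q^m`. -/
theorem finrank_reedMuller_le (r m : ℕ) :
    Module.finrank (ZMod 2) (reedMuller r m) ≤ (m + 1) ^ r := by
  rw [← Nat.pow_le_pow_iff_right (a := 2) (by norm_num), ← natCard_reedMuller]
  induction r with
  | zero =>
    have : Function.Injective (fun f : reedMuller 0 m => f.1 0) := by
      intro f g hfg
      obtain ⟨c, hc⟩ := exists_eq_const_of_mem_reedMuller_zero f.2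
      obtain ⟨d, hd⟩ := exists_eq_const_of_mem_reedMuller_zero g.2
      ext x
      simp only [hc, hd] at hfg ⊢
      exact hfg
    simpa using Nat.card_le_card_of_injective _ this
  | succ r ih =>
    have hinj : Function.Injective (fun f : reedMuller (r + 1) m =>
        (f.1 0, fun i : Fin m =>
          (⟨fwdDiff (Pi.single i 1) f.1, fwdDiff_mem_reedMuller _ f.2⟩ : reedMuller r m))) := by
      intro f g hfg
      simp only [Prod.mk.injEq, funext_iff, Subtype.mk.injEq] at hfg
      have h0 : ∀ x, (f.1 - g.1) x = (f.1 - g.1) 0 := by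
        refine eq_of_fwdDiff_single_eq_zero fun i => ?_
        funext y
        have := hfg.2 i y
        simp only [fwdDiff, Pi.sub_apply, Pi.zero_apply] at this ⊢
        linear_combination this
      ext x
      have := h0 x
      simp only [Pi.sub_apply, hfg.1, sub_self] at this
      exact sub_eq_zero.1 this
    have h := Nat.card_le_card_of_injective _ hinj
    rw [Nat.card_prod, Nat.card_fun, Nat.card_zmod, Nat.card_fin] at h
    refine h.trans ?_
    calc 2 * Nat.card (reedMuller r m) ^ m ≤ 2 * (2 ^ (m + 1) ^ r) ^ m := by gcongr
      _ = 2 ^ (1 + (m + 1) ^ r * m) := by rw [pow_add, pow_one, pow_mul]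
      _ ≤ 2 ^ (m + 1) ^ (r + 1) := by
        refine Nat.pow_le_pow_right (by norm_num) ?_
        have : 1 ≤ (m + 1) ^ r := Nat.one_le_pow _ _ (by omega)
        rw [pow_succ, mul_add, mul_one]
        omega

/-- The squarefree monomials of degree `r` are independent: at the indicator point of an `r`-set
`T`, only the monomial of `T` itself is nonzero. -/
theorem choose_le_finrank_reedMuller (r m : ℕ) :
    m.choose r ≤ Module.finrank (ZMod 2) (reedMuller r m) := by
  classical
  let ι := {S : Finset (Fin m) // S.card = r}
  let e : (S : Finset (Fin m)) → (Fin m →₀ ℕ) := fun S => ∑ i ∈ S, Finsupp.single i 1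
  have hdeg : ∀ S, (e S).degree = S.card := by
    intro S
    simp [e, map_sum, Finsupp.degree_single]
  have hval : ∀ S (x : Fin m → ZMod 2), monomialFun (e S) x = ∏ i ∈ S, x i := by
    intro S x
    induction S using Finset.induction_on with
    | empty => simp [e, monomialFun]
    | insert i S hi ih =>
      rw [Finset.prod_insert hi, ← ih]
      simp only [e, Finset.sum_insert hi, monomialFun_single_add]
  let g : ι → reedMuller r m := fun S =>
    ⟨monomialFun (e S.1), monomialFun_mem_reedMuller _ (by rw [hdeg, S.2])⟩
  have hg : LinearIndependent (ZMod 2) g := by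
    rw [Fintype.linearIndependent_iff]
    intro c hc T
    have h1 := congrArg (fun f : reedMuller r m => f.1 fun i => if i ∈ T.1 then 1 else 0) hc
    simp only [Submodule.coe_sum, Finset.sum_apply, Submodule.coe_smul, Pi.smul_apply, smul_eq_mul,
      Submodule.coe_zero, Pi.zero_apply, g, hval] at h1
    rw [Finset.sum_eq_single T] at h1
    · rwa [Finset.prod_eq_one fun i hi => if_pos hi, mul_one] at h1
    · intro S _ hST
      obtain ⟨i, hiS, hiT⟩ : ∃ i ∈ S.1, i ∉ T.1 := by
        by_contra! h
        exact hST (Subtype.ext (Finset.eq_of_subset_of_card_le h (by rw [S.2, T.2])))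
      rw [Finset.prod_eq_zero hiS (by simp [hiT]), mul_zero]
    · simp
  have := hg.fintype_card_le_finrank
  rwa [Fintype.card_finset_len, Fintype.card_fin] at this

end ReedMuller

/-! ### Uniform deviation of averages of bounded functions -/

section UniformDeviation

/-- The sign character of `𝔽₂`. -/
noncomputable def sgn (z : ZMod 2) : ℝ := if z = 0 then 1 else -1

@[simp] theorem sgn_zero : sgn 0 = 1 := by simp [sgn]

@[simp] theorem sgn_one : sgn 1 = -1 := by simp [sgn]

theorem forall_zmod_two {p : ZMod 2 → Prop} : (∀ z, p z) ↔ p 0 ∧ p 1 :=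
  ⟨fun h => ⟨h 0, h 1⟩, fun h z => by
    rcases (by decide +revert : z = 0 ∨ z = 1) with rfl | rfl
    exacts [h.1, h.2]⟩

theorem sgn_add (a b : ZMod 2) : sgn (a + b) = sgn a * sgn b := by
  revert a b
  have h : (1 + 1 : ZMod 2) = 0 := by decide
  simp [forall_zmod_two, h]

theorem sgn_sub (a b : ZMod 2) : sgn (a - b) = sgn a * sgn b := by
  rw [CharTwo.sub_eq_add, sgn_add]

theorem abs_sgn (z : ZMod 2) : |sgn z| = 1 := by
  revert z
  simp [forall_zmod_two]

theorem sum_zmod_two {M : Type*} [AddCommMonoid M] (g : ZMod 2 → M) : ∑ z, g z = g 0 + g 1 :=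
  Fin.sum_univ_two g

theorem sum_pi_fin_succ {n : ℕ} {M : Type*} [AddCommMonoid M] (F : (Fin (n + 1) → ZMod 2) → M) :
    ∑ σ, F σ = ∑ σ : Fin n → ZMod 2, (F (Fin.cons 0 σ) + F (Fin.cons 1 σ)) := by
  rw [← (Fin.consEquiv fun _ : Fin (n + 1) => ZMod 2).sum_comp, Fintype.sum_prod_type,
    sum_zmod_two, Finset.sum_add_distrib]
  rfl

theorem le_iSup_of_finite {ι : Type*} [Finite ι] (a : ι → ℝ) (j : ι) : a j ≤ ⨆ j, a j :=
  le_ciSup (Set.finite_range a).bddAbove j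

/-- Whichever of `a j`, `b j` is the maximum, the minimum at `k` is bounded by the other function.
This is the two-point case of the contraction principle. -/
theorem iSup_max_add_iSup_min_le {ι : Type*} [Finite ι] [Nonempty ι] (a b : ι → ℝ) :
    (⨆ j, max (a j) (b j)) + (⨆ j, min (a j) (b j)) ≤ (⨆ j, a j) + ⨆ j, b j := by
  have h : ∀ j k, max (a j) (b j) + min (a k) (b k) ≤ (⨆ j, a j) + ⨆ j, b j := by
    intro j k
    rcases max_choice (a j) (b j) with h | h <;> rw [h]
    · exact add_le_add (le_iSup_of_finite a j) ((min_le_right _ _).trans (le_iSup_of_finite b k))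
    · rw [add_comm]
      exact add_le_add ((min_le_left _ _).trans (le_iSup_of_finite a k)) (le_iSup_of_finite b j)
  rw [← le_sub_iff_add_le]
  refine ciSup_le fun j => ?_
  rw [le_sub_comm]
  refine ciSup_le fun k => ?_
  linarith [h j k]

/-- The contraction principle for the absolute value. -/
theorem sum_iSup_exp_abs_le {ι : Type*} [Finite ι] [Nonempty ι] (n : ℕ) :
    ∀ (A : ι → ℝ) (x : Fin n → ι → ℝ),
    ∑ σ : Fin n → ZMod 2, ⨆ j, Real.exp (A j + ∑ i, sgn (σ i) * |x i j|) ≤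
      ∑ σ : Fin n → ZMod 2, ⨆ j, Real.exp (A j + ∑ i, sgn (σ i) * x i j) := by
  induction n with
  | zero => intro A x; simp
  | succ n ih =>
    intro A x
    rw [sum_pi_fin_succ, sum_pi_fin_succ]
    simp only [Fin.sum_univ_succ, Fin.cons_zero, Fin.cons_succ, sgn_zero, sgn_one, ← add_assoc]
    rw [Finset.sum_add_distrib]
    refine (add_le_add (ih _ _) (ih _ _)).trans ?_
    rw [← Finset.sum_add_distrib]
    refine Finset.sum_le_sum fun σ _ => ?_
    -- With the other signs fixed, replacing `x` by `|x|` sorts the two exponents `± x` into their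
    -- maximum and minimum.
    refine le_trans (le_of_eq ?_) (iSup_max_add_iSup_min_le _ _)
    congr 1 <;> refine iSup_congr fun j => ?_
    · rw [← Real.exp_monotone.map_max]
      congr 1
      rcases le_total 0 (x 0 j) with h | h
      · rw [abs_of_nonneg h, max_eq_left (by linarith)]
      · rw [abs_of_nonpos h, max_eq_right (by linarith)]
        ring
    · rw [← Real.exp_monotone.map_min]
      congr 1
      rcases le_total 0 (x 0 j) with h | h
      · rw [abs_of_nonneg h, min_eq_right (by linarith)]
      · rw [abs_of_nonpos h, min_eq_left (by linarith)]
        ring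

/-- Jensen's inequality, from the tangent line of `exp` at the mean. -/
theorem card_mul_exp_mean_le {κ : Type*} (s : Finset κ) (y : κ → ℝ) :
    s.card * Real.exp ((∑ x ∈ s, y x) / s.card) ≤ ∑ x ∈ s, Real.exp (y x) := by
  rcases s.eq_empty_or_nonempty with rfl | hs
  · simp
  have hc : (s.card : ℝ) ≠ 0 := by simpa using hs.ne_empty
  set c := (∑ x ∈ s, y x) / s.card with hcdef
  have hsum : ∑ x ∈ s, y x = s.card * c := by rw [hcdef]; field_simp
  calc (s.card : ℝ) * Real.exp c = ∑ x ∈ s, Real.exp c * (y x - c + 1) := by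
        rw [← Finset.mul_sum, Finset.sum_add_distrib, Finset.sum_sub_distrib, hsum]
        simp [mul_comm]
    _ ≤ ∑ x ∈ s, Real.exp c * Real.exp (y x - c) :=
        Finset.sum_le_sum fun x _ =>
          mul_le_mul_of_nonneg_left (Real.add_one_le_exp _) (Real.exp_pos _).le
    _ = _ := Finset.sum_congr rfl fun x _ => by rw [← Real.exp_add]; congr 1; ring

theorem sum_pi_prod {T R : Type*} [Fintype T] [CommSemiring R] {n : ℕ} (g : Fin n → T → R) :
    ∑ t : Fin n → T, ∏ i, g i (t i) = ∏ i, ∑ x, g i x := by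
  classical
  rw [Finset.prod_univ_sum, Fintype.piFinset_univ]

/-- Exchange of the two samples at the positions where `σ` is nonzero. -/
def swapSamples {T : Type*} {n : ℕ} (σ : Fin n → ZMod 2) :
    Equiv.Perm ((Fin n → T) × (Fin n → T)) :=
  Function.Involutive.toPerm
    (fun p => (fun i => if σ i = 0 then p.1 i else p.2 i, fun i => if σ i = 0 then p.2 i else p.1 i))
    (fun p => by ext i <;> by_cases h : σ i = 0 <;> simp [h])

/-- Exchanging the `i`-th entries of the two samples flips the sign of the `i`-th difference and
permutes the pairs of samples. -/
theorem sum_iSup_swapSamples {ι T : Type*} [Fintype T] {n : ℕ} (f : ι → T → ℝ) (l : ℝ) (σ : Fin n → ZMod 2) :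
    ∑ p : (Fin n → T) × (Fin n → T), ⨆ j, Real.exp (l * ∑ i, (f j (p.1 i) - f j (p.2 i))) =
      ∑ p : (Fin n → T) × (Fin n → T),
        ⨆ j, Real.exp (l * ∑ i, sgn (σ i) * (f j (p.1 i) - f j (p.2 i))) := by
  rw [← Equiv.sum_comp (swapSamples σ)]
  refine Finset.sum_congr rfl fun p _ => iSup_congr fun j => ?_
  congr 2
  refine Finset.sum_congr rfl fun i _ => ?_
  have h1 : (swapSamples σ p).1 i = if σ i = 0 then p.1 i else p.2 i := rfl
  have h2 : (swapSamples σ p).2 i = if σ i = 0 then p.2 i else p.1 i := rfl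
  by_cases h : σ i = 0 <;> simp [h1, h2, sgn, h]

theorem sum_add_one_pi {n : ℕ} (F : (Fin n → ZMod 2) → ℝ) :
    ∑ σ : Fin n → ZMod 2, F (fun i => σ i + 1) = ∑ σ, F σ :=
  Equiv.sum_comp (Equiv.addRight (1 : Fin n → ZMod 2)) F

/-- The symmetrization inequality for exponential moments. -/
theorem sum_iSup_exp_sub_mean_le {ι T : Type*} [Finite ι] [Nonempty ι] [Fintype T] {n : ℕ}
    [Nonempty T] (f : ι → T → ℝ) (l : ℝ) :
    2 ^ n * ∑ t : Fin n → T,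
        ⨆ j, Real.exp (l * (∑ i, f j (t i) - n * ((∑ x, f j x) / Fintype.card T))) ≤
      ∑ t : Fin n → T, ∑ σ : Fin n → ZMod 2,
        ⨆ j, Real.exp (2 * l * ∑ i, sgn (σ i) * f j (t i)) := by
  have hN : (0 : ℝ) < Fintype.card T := by exact_mod_cast Fintype.card_pos
  -- The true mean is replaced by an independent second sample, using Jensen.
  have ha : ∀ t : Fin n → T, (Fintype.card T : ℝ) ^ n *
      (⨆ j, Real.exp (l * (∑ i, f j (t i) - n * ((∑ x, f j x) / Fintype.card T)))) ≤
      ∑ t' : Fin n → T, ⨆ j, Real.exp (l * ∑ i, (f j (t i) - f j (t' i))) := by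
    intro t
    rw [Real.mul_iSup_of_nonneg (by positivity)]
    refine ciSup_le fun j => ?_
    refine le_trans ?_ (Finset.sum_le_sum fun t' _ => le_iSup_of_finite
      (fun j => Real.exp (l * ∑ i, (f j (t i) - f j (t' i)))) j)
    have h1 : ∀ t' : Fin n → T, Real.exp (l * ∑ i, (f j (t i) - f j (t' i))) =
        Real.exp (l * ∑ i, f j (t i)) * ∏ i, Real.exp (-l * f j (t' i)) := by
      intro t'
      rw [← Real.exp_sum, ← Real.exp_add, Finset.sum_sub_distrib, ← Finset.mul_sum]
      congr 1
      ring
    simp only [h1]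
    rw [← Finset.mul_sum, sum_pi_prod (fun _ x => Real.exp (-l * f j x)), Finset.prod_const, Finset.card_univ, Fintype.card_fin]
    have h2 := card_mul_exp_mean_le (Finset.univ : Finset T) (fun x => -l * f j x)
    rw [Finset.card_univ, ← Finset.mul_sum] at h2
    have h3 : Real.exp (l * (∑ i, f j (t i) - n * ((∑ x, f j x) / Fintype.card T))) =
        Real.exp (l * ∑ i, f j (t i)) *
          Real.exp (-l * (∑ x, f j x) / Fintype.card T) ^ n := by
      rw [← Real.exp_nat_mul, ← Real.exp_add]
      congr 1
      ring
    rw [h3, mul_left_comm, ← mul_pow]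
    gcongr
  have hb : 2 ^ n * ∑ p : (Fin n → T) × (Fin n → T),
        (⨆ j, Real.exp (l * ∑ i, (f j (p.1 i) - f j (p.2 i)))) =
      ∑ σ : Fin n → ZMod 2, ∑ p : (Fin n → T) × (Fin n → T),
        ⨆ j, Real.exp (l * ∑ i, sgn (σ i) * (f j (p.1 i) - f j (p.2 i))) := by
    simp_rw [← sum_iSup_swapSamples f l]
    simp
  -- The two samples are separated by `exp (a + b) ≤ (exp (2a) + exp (2b)) / 2`; this is the source
  -- of the factor 2 in the exponent.
  have hc : ∀ (σ : Fin n → ZMod 2) (p : (Fin n → T) × (Fin n → T)),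
      (⨆ j, Real.exp (l * ∑ i, sgn (σ i) * (f j (p.1 i) - f j (p.2 i)))) ≤
      ((⨆ j, Real.exp (2 * l * ∑ i, sgn (σ i) * f j (p.1 i))) +
        ⨆ j, Real.exp (2 * l * ∑ i, sgn (σ i + 1) * f j (p.2 i))) / 2 := by
    intro σ p
    refine ciSup_le fun j => ?_
    have h1 := le_iSup_of_finite (fun j => Real.exp (2 * l * ∑ i, sgn (σ i) * f j (p.1 i))) j
    have h2 := le_iSup_of_finite (fun j => Real.exp (2 * l * ∑ i, sgn (σ i + 1) * f j (p.2 i))) j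
    refine le_trans ?_ (div_le_div_of_nonneg_right (add_le_add h1 h2) zero_le_two)
    set a := l * ∑ i, sgn (σ i) * f j (p.1 i) with hadef
    set b := l * ∑ i, sgn (σ i + 1) * f j (p.2 i) with hbdef
    have h3 : l * ∑ i, sgn (σ i) * (f j (p.1 i) - f j (p.2 i)) = a + b := by
      rw [hadef, hbdef, ← mul_add, ← Finset.sum_add_distrib]
      congr 1
      refine Finset.sum_congr rfl fun i _ => ?_
      rw [sgn_add, sgn_one]
      ring
    have h4 : ∀ y : ℝ, 2 * l * y = l * y + l * y := fun y => by ring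
    rw [h3, h4, h4, Real.exp_add, Real.exp_add, Real.exp_add]
    nlinarith [sq_nonneg (Real.exp a - Real.exp b)]
  have hd : ∑ σ : Fin n → ZMod 2, ∑ p : (Fin n → T) × (Fin n → T),
      ((⨆ j, Real.exp (2 * l * ∑ i, sgn (σ i) * f j (p.1 i))) +
        ⨆ j, Real.exp (2 * l * ∑ i, sgn (σ i + 1) * f j (p.2 i))) / 2 =
      (Fintype.card T : ℝ) ^ n * ∑ t : Fin n → T, ∑ σ : Fin n → ZMod 2,
        ⨆ j, Real.exp (2 * l * ∑ i, sgn (σ i) * f j (t i)) := by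
    rw [Finset.sum_comm, Fintype.sum_prod_type]
    simp only [← Finset.sum_div, Finset.sum_add_distrib]
    simp only [Finset.sum_const, Finset.card_univ, Fintype.card_fun, Fintype.card_fin, nsmul_eq_mul]
    rw [← Finset.mul_sum]
    have : ∀ t : Fin n → T, ∑ σ : Fin n → ZMod 2,
        (⨆ j, Real.exp (2 * l * ∑ i, sgn (σ i + 1) * f j (t i))) =
        ∑ σ : Fin n → ZMod 2, ⨆ j, Real.exp (2 * l * ∑ i, sgn (σ i) * f j (t i)) := fun t =>
      sum_add_one_pi fun σ => ⨆ j, Real.exp (2 * l * ∑ i, sgn (σ i) * f j (t i))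
    simp only [this]
    push_cast
    ring
  have hfin : (Fintype.card T : ℝ) ^ n * (2 ^ n * ∑ t : Fin n → T,
        ⨆ j, Real.exp (l * (∑ i, f j (t i) - n * ((∑ x, f j x) / Fintype.card T)))) ≤
      (Fintype.card T : ℝ) ^ n * ∑ t : Fin n → T, ∑ σ : Fin n → ZMod 2,
        ⨆ j, Real.exp (2 * l * ∑ i, sgn (σ i) * f j (t i)) := by
    rw [← hd, mul_left_comm, Finset.mul_sum]
    refine le_trans (mul_le_mul_of_nonneg_left (Finset.sum_le_sum fun t _ => ha t)
      (by positivity)) ?_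
    rw [← Fintype.sum_prod_type', hb]
    exact Finset.sum_le_sum fun σ _ => Finset.sum_le_sum fun p _ => hc σ p
  exact le_of_mul_le_mul_left hfin (by positivity)

theorem sum_exp_sgn_le {n : ℕ} (μ : ℝ) (x : Fin n → ℝ) (hx : ∀ i, |x i| ≤ 1) :
    ∑ σ : Fin n → ZMod 2, Real.exp (μ * ∑ i, sgn (σ i) * x i) ≤ 2 ^ n * Real.exp (n * (μ ^ 2 / 2)) := by
  have h1 : ∀ σ : Fin n → ZMod 2, Real.exp (μ * ∑ i, sgn (σ i) * x i) =
      ∏ i, Real.exp (μ * (sgn (σ i) * x i)) := fun σ => by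
    rw [← Real.exp_sum, Finset.mul_sum]
  simp only [h1]
  rw [sum_pi_prod (fun i z => Real.exp (μ * (sgn z * x i))), Real.exp_nat_mul, ← mul_pow]
  calc ∏ i, ∑ z, Real.exp (μ * (sgn z * x i)) ≤ ∏ _i : Fin n, (2 * Real.exp (μ ^ 2 / 2)) := by
        refine Finset.prod_le_prod (fun i _ => by positivity) fun i _ => ?_
        rw [sum_zmod_two]
        have h2 := Real.cosh_le_exp_half_sq (μ * x i)
        have h3 : Real.exp ((μ * x i) ^ 2 / 2) ≤ Real.exp (μ ^ 2 / 2) := by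
          apply Real.exp_le_exp.2
          have : x i ^ 2 ≤ 1 := (sq_le_one_iff_abs_le_one _).2 (hx i)
          nlinarith [sq_nonneg μ]
        rw [Real.cosh_eq] at h2
        simp only [sgn_zero, sgn_one, one_mul, neg_mul, mul_neg]
        linarith
    _ = _ := by simp

/-- The average of the functions `χ c`, `c ∈ s`. -/
noncomputable def avgFun {T κ : Type*} (χ : κ → T → ℝ) (s : Finset κ) (x : T) : ℝ := (∑ c ∈ s, χ c x) / s.card

/-- Uniformly over all nonempty families `s`, the empirical mean of `|avgFun χ s|` rarely exceeds
its mean by more than `ε / 2`. -/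
theorem card_deviation_le {T κ : Type*} [Fintype T] [Fintype κ] {n : ℕ} [Nonempty T] [Nonempty κ] (χ : κ → T → ℝ) (hχ : ∀ c x, |χ c x| ≤ 1) {ε : ℝ}
    (hε : 0 ≤ ε) (B : Finset (Fin n → T))
    (hB : ∀ t ∈ B, ∃ s : Finset κ, s.Nonempty ∧
      n * ((∑ x, |avgFun χ s x|) / Fintype.card T) + n * ε / 2 ≤ ∑ i, |avgFun χ s (t i)|) :
    (B.card : ℝ) ≤
      (Fintype.card T : ℝ) ^ n * (Fintype.card κ * Real.exp (-(ε ^ 2 * n / 32))) := by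
  let ι' := {s : Finset κ // s.Nonempty}
  have : Nonempty ι' := ⟨⟨Finset.univ, Finset.univ_nonempty⟩⟩
  -- This minimizes the final exponent `n (2l)² / 2 - l n ε / 2`, giving `-ε² n / 32`.
  set l := ε / 8 with hl
  set F : (Fin n → T) → ℝ := fun t => ⨆ s : ι', Real.exp (l * (∑ i, |avgFun χ s.1 (t i)| -
    n * ((∑ x, |avgFun χ s.1 x|) / Fintype.card T))) with hF
  have hF0 : ∀ t, 0 ≤ F t := fun t => Real.iSup_nonneg fun s => (Real.exp_pos _).le
  have h1 : 2 ^ n * ∑ t, F t ≤ ∑ t : Fin n → T, ∑ σ : Fin n → ZMod 2,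
        ⨆ s : ι', Real.exp (2 * l * ∑ i, sgn (σ i) * |avgFun χ s.1 (t i)|) :=
    sum_iSup_exp_sub_mean_le (fun (s : ι') x => |avgFun χ s.1 x|) l
  have h2 : ∀ t : Fin n → T, ∑ σ : Fin n → ZMod 2,
        (⨆ s : ι', Real.exp (2 * l * ∑ i, sgn (σ i) * |avgFun χ s.1 (t i)|)) ≤
      Fintype.card κ * (2 ^ n * Real.exp (n * ((2 * l) ^ 2 / 2))) := by
    intro t
    have hc := sum_iSup_exp_abs_le n (fun _ : ι' => 0)
      (fun i s => 2 * l * avgFun χ s.1 (t i))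
    have e : ∀ (σ : Fin n → ZMod 2) (g : Fin n → ℝ),
        (0 : ℝ) + ∑ i, sgn (σ i) * (2 * l * g i) = 2 * l * ∑ i, sgn (σ i) * g i := by
      intro σ g
      rw [zero_add, Finset.mul_sum]
      exact Finset.sum_congr rfl fun i _ => by ring
    simp only [abs_mul (2 * l), abs_of_nonneg (show 0 ≤ 2 * l by positivity), e] at hc
    refine hc.trans ?_
    calc _ ≤ ∑ σ : Fin n → ZMod 2, ∑ c, Real.exp (2 * l * ∑ i, sgn (σ i) * χ c (t i)) := by
          refine Finset.sum_le_sum fun σ _ => ciSup_le fun s => ?_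
          have hpos : (1 : ℝ) ≤ s.1.card := by exact_mod_cast s.2.card_pos
          have h3 := card_mul_exp_mean_le s.1 fun c => 2 * l * ∑ i, sgn (σ i) * χ c (t i)
          have h4 : (∑ c ∈ s.1, 2 * l * ∑ i, sgn (σ i) * χ c (t i)) / s.1.card =
              2 * l * ∑ i, sgn (σ i) * avgFun χ s.1 (t i) := by
            rw [← Finset.mul_sum, Finset.sum_comm, mul_div_assoc, Finset.sum_div]
            congr 1
            refine Finset.sum_congr rfl fun i _ => ?_
            rw [← Finset.mul_sum, avgFun, mul_div_assoc]
          rw [h4] at h3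
          -- The supremum over all families is bounded by a sum over single elements of `κ`.
          refine le_trans ?_ (h3.trans (Finset.sum_le_sum_of_subset_of_nonneg
            (Finset.subset_univ _) fun _ _ _ => (Real.exp_pos _).le))
          exact le_mul_of_one_le_left (Real.exp_pos _).le hpos
      _ = ∑ c, ∑ σ : Fin n → ZMod 2, Real.exp (2 * l * ∑ i, sgn (σ i) * χ c (t i)) :=
          Finset.sum_comm
      _ ≤ ∑ _c : κ, 2 ^ n * Real.exp (n * ((2 * l) ^ 2 / 2)) :=
          Finset.sum_le_sum fun c _ => sum_exp_sgn_le _ _ fun i => hχ c _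
      _ = _ := by simp
  have h3 : ∑ t, F t ≤ (Fintype.card T : ℝ) ^ n *
      (Fintype.card κ * Real.exp (n * ((2 * l) ^ 2 / 2))) := by
    have h5 := h1.trans (Finset.sum_le_sum fun t _ => h2 t)
    rw [Finset.sum_const, Finset.card_univ, Fintype.card_fun, Fintype.card_fin, nsmul_eq_mul] at h5
    push_cast at h5
    refine le_of_mul_le_mul_left (h5.trans (le_of_eq ?_)) (show (0 : ℝ) < 2 ^ n by positivity)
    ring
  have h4 : (B.card : ℝ) * Real.exp (l * (n * ε / 2)) ≤ ∑ t, F t := by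
    rw [← nsmul_eq_mul]
    refine (Finset.card_nsmul_le_sum B F _ fun t ht => ?_).trans
      (Finset.sum_le_sum_of_subset_of_nonneg (Finset.subset_univ _) fun t _ _ => hF0 t)
    obtain ⟨s, hs, hst⟩ := hB t ht
    refine le_trans ?_ (le_iSup_of_finite (fun s : ι' => Real.exp (l * (∑ i, |avgFun χ s.1 (t i)| -
      n * ((∑ x, |avgFun χ s.1 x|) / Fintype.card T)))) ⟨s, hs⟩)
    apply Real.exp_le_exp.2
    refine mul_le_mul_of_nonneg_left ?_ (by positivity)
    simp only
    linarith
  have h5 := h4.trans h3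
  rw [← le_div_iff₀ (Real.exp_pos _), mul_div_assoc, mul_div_assoc, ← Real.exp_sub] at h5
  refine h5.trans (le_of_eq ?_)
  congr 3
  rw [hl]
  ring

end UniformDeviation

/-! ### The weight distribution of Reed-Muller codes -/

section WeightDistribution

/-- All fibres of a surjective homomorphism have the same size, so it carries the uniform
distribution to the uniform one. -/
theorem card_mul_sum_comp_of_surjective {G H : Type*} [AddGroup G] [AddGroup H] [Fintype G]
    [Fintype H] (φ : G →+ H) (hφ : Function.Surjective φ) (g : H → ℝ) :
    (Fintype.card H : ℝ) * ∑ x, g (φ x) = Fintype.card G * ∑ y, g y := by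
  classical
  set c := (Finset.univ.filter fun x => φ x = 0).card with hc
  have hfib : ∀ y, (Finset.univ.filter fun x => φ x = y).card = c := fun y =>
    AddMonoidHom.card_fiber_eq_of_mem_range φ (hφ y) (hφ 0)
  have h1 : ∀ g : H → ℝ, ∑ x, g (φ x) = c * ∑ y, g y := by
    intro g
    rw [← Finset.sum_fiberwise Finset.univ φ, Finset.mul_sum]
    refine Finset.sum_congr rfl fun y _ => ?_
    rw [Finset.sum_congr rfl (g := fun _ => g y) fun x hx => by rw [(Finset.mem_filter.1 hx).2],
      Finset.sum_const, hfib, nsmul_eq_mul]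
  have h2 := h1 fun _ => 1
  simp only [Finset.sum_const, Finset.card_univ, nsmul_eq_mul, mul_one] at h2
  rw [h1, h2]
  ring

variable {m l : ℕ}

/-- The point with parameter `u` of the affine subspace described by `ω`. -/
def affinePoint (u : Fin l → ZMod 2) (ω : (Fin m → ZMod 2) × (Fin l → Fin m → ZMod 2)) :
    Fin m → ZMod 2 :=
  ω.1 + ∑ j, u j • ω.2 j

/-- Two points of a random affine subspace. -/
def affinePair (u v : Fin l → ZMod 2) :
    (Fin m → ZMod 2) × (Fin l → Fin m → ZMod 2) →+ (Fin m → ZMod 2) × (Fin m → ZMod 2) :=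
  AddMonoidHom.mk' (fun ω => (affinePoint u ω, affinePoint v ω)) fun ω ω' => by
    ext i <;> simp [affinePoint, Finset.sum_add_distrib] <;> ring

/-- At a coordinate `j` where `u` and `v` differ, the direction `z - y` leads from `y` to `z`; all
other directions can be 0. Consequently, distinct points of a random affine subspace are pairwise
independent. -/
theorem affinePair_surjective {u v : Fin l → ZMod 2} (h : u ≠ v) :
    Function.Surjective (affinePair (m := m) u v) := by
  rintro ⟨y, z⟩
  obtain ⟨j, hj⟩ := Function.ne_iff.1 h
  have hj1 : v j = u j + 1 := by
    generalize u j = p at *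
    generalize v j = q at *
    revert p q
    decide
  refine ⟨(y - u j • (z - y), Pi.single j (z - y)), ?_⟩
  have hs : ∀ w : Fin l → ZMod 2,
      ∑ i, w i • (Pi.single j (z - y) : Fin l → Fin m → ZMod 2) i = w j • (z - y) := by
    intro w
    rw [Finset.sum_eq_single j]
    · simp
    · intro i _ hij
      simp [hij]
    · simp
  change (affinePoint u _, affinePoint v _) = _
  simp only [affinePoint, hs, hj1, add_smul, one_smul]
  ext i
  · simp
  · simp only [Pi.add_apply, Pi.sub_apply, Pi.smul_apply, smul_eq_mul]
    ring

/-- Chebyshev's inequality for the sum of `sgn ∘ f` over a random affine subspace. -/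
theorem card_nonpos_sum_sgn_le (f : (Fin m → ZMod 2) → ZMod 2) (x : Fin m → ZMod 2) {ε : ℝ}
    (hε : 0 < ε) (hf : ε * Fintype.card (Fin m → ZMod 2) ≤ ∑ y, sgn (f y))
    (B : Finset ((Fin m → ZMod 2) × (Fin l → Fin m → ZMod 2)))
    (hB : ∀ ω ∈ B, ∑ u, sgn (f (x + affinePoint u ω)) ≤ 0) :
    (B.card : ℝ) * (2 ^ l * ε ^ 2) ≤
      4 * Fintype.card ((Fin m → ZMod 2) × (Fin l → Fin m → ZMod 2)) := by
  classical
  set N : ℝ := (Fintype.card (Fin m → ZMod 2) : ℝ) with hNdef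
  have hN : 0 < N := by rw [hNdef]; exact_mod_cast Fintype.card_pos
  set μ : ℝ := (∑ y, sgn (f y)) / N with hμ
  have hμε : ε ≤ μ := by rwa [hμ, le_div_iff₀ hN]
  have hμ1 : μ ≤ 1 := by
    rw [hμ, div_le_one hN, hNdef]
    calc ∑ y, sgn (f y) ≤ ∑ _y : Fin m → ZMod 2, (1 : ℝ) :=
          Finset.sum_le_sum fun y _ => (le_abs_self _).trans (abs_sgn _).le
      _ = _ := by simp
  set g : (Fin m → ZMod 2) → ℝ := fun y => sgn (f y) - μ with hg
  have hg0 : ∑ y, g y = 0 := by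
    simp only [hg, Finset.sum_sub_distrib, Finset.sum_const, Finset.card_univ, nsmul_eq_mul]
    rw [hμ, ← hNdef]
    field_simp
    ring
  have hg4 : ∀ y, g y * g y ≤ 4 := by
    intro y
    have := abs_le.1 (abs_sgn (f y)).le
    simp only [hg]
    nlinarith
  have hoff : ∀ u v : Fin l → ZMod 2, u ≠ v →
      ∑ ω, g (x + affinePoint u ω) * g (x + affinePoint v ω) = 0 := by
    intro u v huv
    have h := card_mul_sum_comp_of_surjective (affinePair (m := m) u v) (affinePair_surjective huv)
      fun p => g (x + p.1) * g (x + p.2)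
    have h0 : ∑ p : (Fin m → ZMod 2) × (Fin m → ZMod 2), g (x + p.1) * g (x + p.2) = 0 := by
      rw [Fintype.sum_prod_type]
      simp only [← Finset.mul_sum, ← Finset.sum_mul]
      have hx : ∑ y, g (x + y) = 0 := (Equiv.sum_comp (Equiv.addLeft x) g).trans hg0
      rw [hx, mul_zero]
    rw [h0, mul_zero] at h
    refine (mul_eq_zero.1 h).resolve_left ?_
    exact_mod_cast Fintype.card_ne_zero
  have hsecond : ∑ ω, (∑ u : Fin l → ZMod 2, g (x + affinePoint u ω)) ^ 2 ≤
      2 ^ l * (4 * (Fintype.card ((Fin m → ZMod 2) × (Fin l → Fin m → ZMod 2)) : ℝ)) := by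
    calc ∑ ω, (∑ u : Fin l → ZMod 2, g (x + affinePoint u ω)) ^ 2
        = ∑ u : Fin l → ZMod 2, ∑ v : Fin l → ZMod 2, ∑ ω, g (x + affinePoint u ω) * g (x + affinePoint v ω) := by
          simp only [sq, Finset.sum_mul_sum]
          rw [Finset.sum_comm]
          exact Finset.sum_congr rfl fun u _ => Finset.sum_comm
      _ = ∑ u : Fin l → ZMod 2, ∑ ω, g (x + affinePoint u ω) * g (x + affinePoint u ω) :=
          Finset.sum_congr rfl fun u _ =>
            Finset.sum_eq_single u (fun v _ hv => hoff u v hv.symm) (by simp)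
      _ ≤ ∑ _u : Fin l → ZMod 2, ∑ _ω : (Fin m → ZMod 2) × (Fin l → Fin m → ZMod 2), (4 : ℝ) :=
          Finset.sum_le_sum fun u _ => Finset.sum_le_sum fun ω _ => hg4 _
      _ = _ := by
          simp only [Finset.sum_const, Finset.card_univ, nsmul_eq_mul, Fintype.card_fun,
            ZMod.card, Fintype.card_fin]
          push_cast
          ring
  have hlow : (B.card : ℝ) * (2 ^ l * ε) ^ 2 ≤ ∑ ω, (∑ u : Fin l → ZMod 2, g (x + affinePoint u ω)) ^ 2 := by
    rw [← nsmul_eq_mul]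
    refine (Finset.card_nsmul_le_sum B (fun ω => (∑ u, g (x + affinePoint u ω)) ^ 2) _
      fun ω hω => ?_).trans
      (Finset.sum_le_sum_of_subset_of_nonneg (Finset.subset_univ _) fun _ _ _ => sq_nonneg _)
    -- The sum has mean `2^l μ ≥ 2^l ε`, so a nonpositive value is a deviation of at least `2^l ε`.
    have h1 : ∑ u, g (x + affinePoint u ω) = ∑ u, sgn (f (x + affinePoint u ω)) - 2 ^ l * μ := by
      simp [hg, Finset.sum_sub_distrib]
    have h2 := hB ω hω
    have h3 : 2 ^ l * ε ≤ 2 ^ l * μ := by gcongr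
    have h4 : 0 ≤ 2 ^ l * ε := by positivity
    simp only [h1]
    nlinarith
  have h2l : (0 : ℝ) < 2 ^ l := by positivity
  refine le_of_mul_le_mul_left ?_ h2l
  calc _ = (B.card : ℝ) * (2 ^ l * ε) ^ 2 := by ring
    _ ≤ _ := hlow.trans hsecond

theorem apply_add_affinePoint {h : (Fin m → ZMod 2) → ZMod 2}
    {ω : (Fin m → ZMod 2) × (Fin l → Fin m → ZMod 2)} (h1 : ∀ x, h (x + ω.1) = h x)
    (h2 : ∀ j x, h (x + ω.2 j) = h x) (u : Fin l → ZMod 2) (x : Fin m → ZMod 2) :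
    h (x + affinePoint u ω) = h x := by
  have hper : ∀ j (c : ZMod 2) y, h (y + c • ω.2 j) = h y := by
    intro j c y
    rcases (by decide +revert : c = 0 ∨ c = 1) with rfl | rfl
    · simp
    · simp [h2]
  have hsum : ∀ (s : Finset (Fin l)) y, h (y + ∑ j ∈ s, u j • ω.2 j) = h y := by
    intro s
    induction s using Finset.induction_on with
    | empty => simp
    | insert i s hi ih => intro y; rw [Finset.sum_insert hi, ← add_assoc, ih, hper]
  rw [affinePoint, ← add_assoc, hsum, h1]

open Classical in
/-- The points at which the sign of `f` is not recovered from the derivatives of `f` in the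
directions of the affine subspace described by `ω`. -/
noncomputable def badPoints (f : (Fin m → ZMod 2) → ZMod 2)
    (ω : (Fin m → ZMod 2) × (Fin l → Fin m → ZMod 2)) : Finset (Fin m → ZMod 2) :=
  Finset.univ.filter fun x => ∑ u, sgn (f (x + affinePoint u ω)) ≤ 0

/-- A word of the Reed-Muller code with few bad points is determined by its derivatives. -/
theorem eq_of_fwdDiff_eq {r : ℕ} {f g : (Fin m → ZMod 2) → ZMod 2} (hf : f ∈ reedMuller r m)
    (hg : g ∈ reedMuller r m) (ω : (Fin m → ZMod 2) × (Fin l → Fin m → ZMod 2))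
    (hbf : 2 ^ (r + 1) * (badPoints f ω).card < Fintype.card (Fin m → ZMod 2))
    (hbg : 2 ^ (r + 1) * (badPoints g ω).card < Fintype.card (Fin m → ZMod 2))
    (h1 : fwdDiff ω.1 f = fwdDiff ω.1 g) (h2 : ∀ j, fwdDiff (ω.2 j) f = fwdDiff (ω.2 j) g) :
    f = g := by
  classical
  have hper : ∀ a, fwdDiff a f = fwdDiff a g → ∀ x, (f - g) (x + a) = (f - g) x := by
    intro a ha x
    have := congrFun ha x
    simp only [fwdDiff, Pi.sub_apply] at this ⊢
    linear_combination this
  have hinv := fun u x => apply_add_affinePoint (hper _ h1) (fun j => hper _ (h2 j)) u x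
  by_contra hne
  have hwt := card_le_two_pow_mul_wt r (sub_mem hf hg) (sub_ne_zero.2 hne)
  have hsub : (Finset.univ.filter fun x => (f - g) x ≠ 0) ⊆ badPoints f ω ∪ badPoints g ω := by
    intro x hx
    rw [Finset.mem_filter] at hx
    simp only [badPoints, Finset.mem_union, Finset.mem_filter, Finset.mem_univ, true_and]
    by_contra! hcon
    -- The difference `f - g` is invariant along the subspace, so where it is nonzero the two sign
    -- sums are opposite and one of them is nonpositive.
    have hS : ∑ u, sgn (f (x + affinePoint u ω)) = -∑ u, sgn (g (x + affinePoint u ω)) := by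
      rw [← Finset.sum_neg_distrib]
      refine Finset.sum_congr rfl fun u _ => ?_
      have e : f (x + affinePoint u ω) = g (x + affinePoint u ω) + (f - g) x := by
        rw [← hinv u x]
        simp
      rw [e, sgn_add, sgn, sgn, if_neg hx.2]
      ring
    linarith [hcon.1, hcon.2]
  have h3 := (Finset.card_le_card hsub).trans (Finset.card_union_le _ _)
  have h4 : wt (f - g) ≤ (badPoints f ω).card + (badPoints g ω).card := h3
  have h5 : 2 ^ r * wt (f - g) ≤ 2 ^ r * ((badPoints f ω).card + (badPoints g ω).card) :=
    Nat.mul_le_mul_left _ h4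
  rw [pow_succ] at hbf hbg
  nlinarith

/-- The bound of Kaufman, Lovett and Porat for the number of words of the Reed-Muller code with
bias at least `ε`. -/
theorem card_biased_le {r : ℕ} {ε : ℝ} (hε : 0 < ε) (hl : 2 ^ (r + 5) ≤ ε ^ 2 * 2 ^ l)
    (B : Finset (reedMuller (r + 1) m))
    (hB : ∀ f ∈ B, ε * Fintype.card (Fin m → ZMod 2) ≤ ∑ x, sgn (f.1 x)) :
    B.card ≤ 2 * Nat.card (reedMuller r m) ^ (l + 1) := by
  classical
  let Ω := (Fin m → ZMod 2) × (Fin l → Fin m → ZMod 2)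
  let N := Fintype.card (Fin m → ZMod 2)
  have hN : 0 < N := Fintype.card_pos
  have hΩ : 0 < Fintype.card Ω := Fintype.card_pos
  let good : reedMuller (r + 1) m → Ω → Prop := fun f ω => 2 ^ (r + 2) * (badPoints f.1 ω).card < N
  have hbad : ∀ f ∈ B, 2 ^ (r + 3) * ∑ ω : Ω, (badPoints f.1 ω).card ≤ N * Fintype.card Ω := by
    intro f hf
    have e : ∑ ω : Ω, (badPoints f.1 ω).card =
        ∑ x, (Finset.univ.filter fun ω : Ω =>
          ∑ u, sgn (f.1 (x + affinePoint u ω)) ≤ 0).card := by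
      simp only [badPoints, Finset.card_filter]
      exact Finset.sum_comm
    rw [e, Finset.mul_sum]
    calc _ ≤ ∑ _x : Fin m → ZMod 2, Fintype.card Ω := by
          refine Finset.sum_le_sum fun x _ => ?_
          have h := card_nonpos_sum_sgn_le f.1 x hε (hB f hf)
            (Finset.univ.filter fun ω : Ω => ∑ u, sgn (f.1 (x + affinePoint u ω)) ≤ 0)
            (fun ω hω => (Finset.mem_filter.1 hω).2)
          have h' : (2 : ℝ) ^ (r + 5) * ((Finset.univ.filter fun ω : Ω =>
              ∑ u, sgn (f.1 (x + affinePoint u ω)) ≤ 0).card : ℝ) ≤ 4 * Fintype.card Ω := by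
            refine le_trans ?_ h
            rw [mul_comm (2 ^ l : ℝ), mul_comm]
            gcongr
          have h'' : (2 : ℝ) ^ (r + 3) * ((Finset.univ.filter fun ω : Ω =>
              ∑ u, sgn (f.1 (x + affinePoint u ω)) ≤ 0).card : ℝ) ≤ Fintype.card Ω := by
            have : (2 : ℝ) ^ (r + 5) = 4 * 2 ^ (r + 3) := by ring
            rw [this] at h'
            linarith
          exact_mod_cast h''
      _ = _ := by simp [N]
  -- By Markov's inequality, each `f ∈ B` is good for at least half of all `ω`. For fixed `ω` the
  -- good words are determined by `l + 1` derivatives (`hinj`), and double counting finishes.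
  have hgood : ∀ f ∈ B, Fintype.card Ω ≤ 2 * (Finset.univ.filter fun ω => good f ω).card := by
    intro f hf
    have h1 : (Finset.univ.filter fun ω => good f ω).card +
        (Finset.univ.filter fun ω => ¬ good f ω).card = Fintype.card Ω := by
      rw [← Finset.card_univ]
      convert! Finset.card_filter_add_card_filter_not (s := (Finset.univ : Finset Ω)) (good f)
    have h2 : (Finset.univ.filter fun ω => ¬ good f ω).card * N ≤
        2 ^ (r + 2) * ∑ ω : Ω, (badPoints f.1 ω).card := by
      rw [Finset.mul_sum, ← smul_eq_mul]
      refine (Finset.card_nsmul_le_sum _ (fun ω => 2 ^ (r + 2) * (badPoints f.1 ω).card) N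
        fun ω hω => not_lt.1 (Finset.mem_filter.1 hω).2).trans ?_
      exact Finset.sum_le_sum_of_subset (Finset.subset_univ _)
    have h3 := hbad f hf
    have h4 : 2 * (Finset.univ.filter fun ω => ¬ good f ω).card ≤ Fintype.card Ω := by
      refine Nat.le_of_mul_le_mul_left ?_ hN
      calc _ = 2 * ((Finset.univ.filter fun ω => ¬ good f ω).card * N) := by ring
        _ ≤ 2 * (2 ^ (r + 2) * ∑ ω : Ω, (badPoints f.1 ω).card) := Nat.mul_le_mul_left _ h2
        _ = 2 ^ (r + 3) * ∑ ω : Ω, (badPoints f.1 ω).card := by ring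
        _ ≤ _ := h3
    omega
  have hinj : ∀ ω : Ω, (B.filter fun f => good f ω).card ≤ Nat.card (reedMuller r m) ^ (l + 1) := by
    intro ω
    let Φ : reedMuller (r + 1) m → reedMuller r m × (Fin l → reedMuller r m) := fun f =>
      (⟨fwdDiff ω.1 f.1, fwdDiff_mem_reedMuller _ f.2⟩,
        fun j => ⟨fwdDiff (ω.2 j) f.1, fwdDiff_mem_reedMuller _ f.2⟩)
    have h := Finset.card_le_card_of_injOn (s := B.filter fun f => good f ω)
      (t := Finset.univ) Φ (fun _ _ => Finset.mem_univ _) (by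
        intro f hf g hg hfg
        have hf' := (Finset.mem_filter.1 hf).2
        have hg' := (Finset.mem_filter.1 hg).2
        simp only [Φ, Prod.mk.injEq, Subtype.mk.injEq] at hfg
        refine Subtype.ext (eq_of_fwdDiff_eq f.2 g.2 ω hf' hg' hfg.1 fun j => ?_)
        exact congrArg Subtype.val (congrFun hfg.2 j))
    refine h.trans (le_of_eq ?_)
    rw [Finset.card_univ, ← Nat.card_eq_fintype_card, Nat.card_prod, Nat.card_fun, Nat.card_fin]
    ring
  refine Nat.le_of_mul_le_mul_left ?_ hΩ
  calc Fintype.card Ω * B.card = ∑ _f ∈ B, Fintype.card Ω := by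
        rw [Finset.sum_const, smul_eq_mul, mul_comm]
    _ ≤ ∑ f ∈ B, 2 * (Finset.univ.filter fun ω => good f ω).card := Finset.sum_le_sum hgood
    _ = 2 * ∑ ω : Ω, (B.filter fun f => good f ω).card := by
        rw [← Finset.mul_sum]
        simp only [Finset.card_filter]
        rw [Finset.sum_comm]
    _ ≤ 2 * ∑ _ω : Ω, Nat.card (reedMuller r m) ^ (l + 1) := by
        gcongr with ω _
        exact hinj ω
    _ = _ := by
        rw [Finset.sum_const, Finset.card_univ, smul_eq_mul]
        ring

end WeightDistribution

/-! ### List decodability of sampled Reed-Muller codes -/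

section SampledCode

theorem wt_eq_sum {T : Type*} [Fintype T] (f : T → ZMod 2) :
    (wt f : ℝ) = ∑ x, if f x ≠ 0 then (1 : ℝ) else 0 := by
  classical
  rw [wt, Finset.card_filter]
  push_cast
  exact Finset.sum_congr rfl fun x _ => by congr

theorem sum_sgn_eq {T : Type*} [Fintype T] (f : T → ZMod 2) :
    ∑ x, sgn (f x) = Fintype.card T - 2 * wt f := by
  rw [wt_eq_sum, Finset.mul_sum, ← Finset.card_univ, Finset.card_eq_sum_ones]
  push_cast
  rw [← Finset.sum_sub_distrib]
  refine Finset.sum_congr rfl fun x _ => ?_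
  by_cases h : f x = 0 <;> norm_num [sgn, h]

/-- The lower tail of the weight of a sampled word. -/
theorem card_wt_comp_le {T : Type*} [Fintype T] [Nonempty T] {n : ℕ} (f : T → ZMod 2) (d : ℝ)
    (B : Finset (Fin n → T)) (hB : ∀ t ∈ B, (wt (f ∘ t) : ℝ) ≤ d * n) :
    (B.card : ℝ) ≤ (Fintype.card T : ℝ) ^ n * Real.exp (n * (d - wt f / (2 * Fintype.card T))) := by
  set N : ℝ := (Fintype.card T : ℝ) with hNdef
  have hN : 0 < N := by rw [hNdef]; exact_mod_cast Fintype.card_pos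
  have h1 : ∑ t : Fin n → T, Real.exp (-(wt (f ∘ t) : ℝ)) =
      (∑ x, Real.exp (-(if f x ≠ 0 then (1 : ℝ) else 0))) ^ n := by
    have := sum_pi_prod (n := n) fun _ x => Real.exp (-(if f x ≠ 0 then (1 : ℝ) else 0))
    rw [Finset.prod_const, Finset.card_univ, Fintype.card_fin] at this
    rw [← this]
    refine Finset.sum_congr rfl fun t _ => ?_
    rw [← Real.exp_sum, wt_eq_sum, Finset.sum_neg_distrib]
    rfl
  have h2 : ∑ x, Real.exp (-(if f x ≠ 0 then (1 : ℝ) else 0)) ≤ N * Real.exp (-(wt f / (2 * N))) := by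
    -- Thus `exp (-1_A) ≤ 1 - 1_A / 2`, which accounts for the 2 in the denominator of the exponent.
    have he : Real.exp (-1) ≤ 1 / 2 := by
      rw [Real.exp_neg, inv_eq_one_div]
      exact one_div_le_one_div_of_le two_pos (by linarith [Real.exp_one_gt_d9])
    calc _ ≤ ∑ x, (1 - (if f x ≠ 0 then (1 : ℝ) else 0) / 2) := by
          refine Finset.sum_le_sum fun x _ => ?_
          by_cases h : f x = 0
          · simp [h]
          · simp only [ne_eq, h, not_false_eq_true, if_true]
            linarith
      _ = N - wt f / 2 := by
          rw [Finset.sum_sub_distrib, ← Finset.sum_div, ← wt_eq_sum]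
          simp [hNdef]
      _ = N * (-(wt f / (2 * N)) + 1) := by field_simp; ring
      _ ≤ _ := mul_le_mul_of_nonneg_left (Real.add_one_le_exp _) hN.le
  have h3 : (B.card : ℝ) * Real.exp (-(d * n)) ≤ ∑ t : Fin n → T, Real.exp (-(wt (f ∘ t) : ℝ)) := by
    rw [← nsmul_eq_mul]
    exact (Finset.card_nsmul_le_sum B (fun t => Real.exp (-(wt (f ∘ t) : ℝ))) _ fun t ht =>
      Real.exp_le_exp.2 (neg_le_neg (hB t ht))).trans
      (Finset.sum_le_sum_of_subset_of_nonneg (Finset.subset_univ _) fun _ _ _ => (Real.exp_pos _).le)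
  have h4 : (B.card : ℝ) * Real.exp (-(d * n)) ≤ (N * Real.exp (-(wt f / (2 * N)))) ^ n := by
    refine h3.trans (h1.le.trans ?_)
    gcongr
  rw [← le_div_iff₀ (Real.exp_pos _), mul_pow, ← Real.exp_nat_mul, mul_div_assoc,
    ← Real.exp_sub] at h4
  refine h4.trans (le_of_eq ?_)
  congr 2
  ring

variable {r m : ℕ}

/-- The number of directions is the least power-of-two choice above `2^(r+5) / ε²`. The exponent is
at least 1 because `m > 0`, so it can absorb the factor 2. -/
theorem card_biased_le_pow (hm : 0 < m) {ε : ℝ} (hε : 0 < ε) (hε1 : ε ≤ 1)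
    (B : Finset (reedMuller (r + 1) m))
    (hB : ∀ f ∈ B, ε * Fintype.card (Fin m → ZMod 2) ≤ ∑ x, sgn (f.1 x)) :
    (B.card : ℝ) ≤ (2 ^ (r + 8) / ε ^ 2) ^ (2 ^ r * m ^ r) := by
  have hε2 : 0 < ε ^ 2 := by positivity
  obtain ⟨l, hl1, hl2⟩ := exists_nat_pow_near (x := 2 ^ (r + 5) / ε ^ 2) (y := (2 : ℝ)) (by
    rw [one_le_div hε2]
    exact (pow_le_one₀ hε.le hε1).trans (one_le_pow₀ one_le_two)) one_lt_two
  rw [div_lt_iff₀ hε2] at hl2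
  have h1 := card_biased_le (l := l + 1) hε (by linarith) B hB
  have h2 : Nat.card (reedMuller r m) ≤ 2 ^ (2 ^ r * m ^ r) := by
    rw [natCard_reedMuller, ← mul_pow]
    refine Nat.pow_le_pow_right two_pos ((finrank_reedMuller_le r m).trans ?_)
    exact Nat.pow_le_pow_left (by omega) r
  have hE : 1 ≤ 2 ^ r * m ^ r := Nat.one_le_iff_ne_zero.2 (by positivity)
  have h3 : B.card ≤ (2 ^ (l + 3)) ^ (2 ^ r * m ^ r) := by
    calc B.card ≤ 2 * (2 ^ (2 ^ r * m ^ r)) ^ (l + 1 + 1) := h1.trans (by gcongr)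
      _ ≤ 2 ^ (2 ^ r * m ^ r) * (2 ^ (2 ^ r * m ^ r)) ^ (l + 1 + 1) := by
          gcongr
          exact Nat.le_self_pow (by omega) 2
      _ = _ := by
          rw [← pow_succ', ← pow_mul, ← pow_mul, mul_comm]
  calc (B.card : ℝ) ≤ (2 ^ (l + 3)) ^ (2 ^ r * m ^ r) := by exact_mod_cast h3
    _ ≤ _ := by
      gcongr
      calc (2 : ℝ) ^ (l + 3) = 2 ^ l * 8 := by rw [pow_add]; norm_num
        _ ≤ 2 ^ (r + 5) / ε ^ 2 * 8 := by gcongr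
        _ = _ := by rw [pow_add, pow_add]; ring

/-- The sign functions of the words of the Reed-Muller code. -/
noncomputable def signFun (f : reedMuller r m) (x : Fin m → ZMod 2) : ℝ := sgn (f.1 x)

-- Expanding the square turns `sgn f · sgn g` into `sgn (f - g)`. For fixed `f` the map `g ↦ f - g`
-- is injective, so at most as many differences are biased as there are biased words; each of those
-- contributes at most the trivial bound.
open Classical in
theorem card_mul_sum_sq_avgFun_le (s : Finset (reedMuller r m)) (hs : s.Nonempty) (ε : ℝ)
    (hε : 0 ≤ ε) :
    (s.card : ℝ) * ∑ x, avgFun signFun s x ^ 2 ≤ Fintype.card (Fin m → ZMod 2) *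
      (s.card * ε + (Finset.univ.filter fun f : reedMuller r m =>
        ε * Fintype.card (Fin m → ZMod 2) ≤ ∑ x, sgn (f.1 x)).card) := by
  set A := Finset.univ.filter fun f : reedMuller r m =>
        ε * Fintype.card (Fin m → ZMod 2) ≤ ∑ x, sgn (f.1 x) with hA
  set N : ℝ := (Fintype.card (Fin m → ZMod 2) : ℝ) with hNdef
  have hN : 0 ≤ N := by rw [hNdef]; positivity
  have hc : (0 : ℝ) < s.card := by exact_mod_cast hs.card_pos
  have hrow : ∀ f ∈ s, ∑ g ∈ s, ∑ x, sgn ((f - g : reedMuller r m).1 x) ≤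
      N * (s.card * ε + A.card) := by
    intro f _
    calc ∑ g ∈ s, ∑ x, sgn ((f - g : reedMuller r m).1 x)
        ≤ ∑ g ∈ s, (ε * N + if f - g ∈ A then N else 0) := by
          refine Finset.sum_le_sum fun g _ => ?_
          by_cases h : f - g ∈ A
          · rw [if_pos h]
            calc ∑ x, sgn ((f - g : reedMuller r m).1 x) ≤ ∑ _x : Fin m → ZMod 2, (1 : ℝ) :=
                  Finset.sum_le_sum fun y _ => (le_abs_self _).trans (abs_sgn _).le
              _ = N := by simp [hNdef]
              _ ≤ _ := le_add_of_nonneg_left (by positivity)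
          · rw [if_neg h, add_zero]
            rw [hA, Finset.mem_filter] at h
            push Not at h
            exact (h (Finset.mem_univ _)).le
      _ = N * (s.card * ε + (s.filter fun g => f - g ∈ A).card) := by
          rw [Finset.sum_add_distrib, ← Finset.sum_filter, Finset.sum_const, Finset.sum_const]
          simp only [nsmul_eq_mul]
          ring
      _ ≤ _ := by
          refine mul_le_mul_of_nonneg_left (add_le_add le_rfl (Nat.cast_le.2 ?_)) hN
          refine Finset.card_le_card_of_injOn (fun g => f - g)
            (fun g hg => (Finset.mem_filter.1 hg).2) ?_
          intro g _ g' _ h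
          exact sub_right_injective h
  have hsq : (s.card : ℝ) ^ 2 * ∑ x, avgFun signFun s x ^ 2 =
      ∑ f ∈ s, ∑ g ∈ s, ∑ x, sgn ((f - g : reedMuller r m).1 x) := by
    have e : ∀ x, (s.card : ℝ) ^ 2 * avgFun signFun s x ^ 2 =
        ∑ f ∈ s, ∑ g ∈ s, sgn ((f - g : reedMuller r m).1 x) := by
      intro x
      rw [← mul_pow, avgFun, mul_div_cancel₀ _ hc.ne', sq, Finset.sum_mul_sum]
      refine Finset.sum_congr rfl fun f _ => Finset.sum_congr rfl fun g _ => ?_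
      exact (sgn_sub _ _).symm
    rw [Finset.mul_sum, Finset.sum_congr rfl fun x _ => e x, Finset.sum_comm]
    exact Finset.sum_congr rfl fun f _ => Finset.sum_comm
  refine le_of_mul_le_mul_left ?_ hc
  calc _ = (s.card : ℝ) ^ 2 * ∑ x, avgFun signFun s x ^ 2 := by ring
    _ ≤ ∑ _f ∈ s, N * (s.card * ε + A.card) := hsq.le.trans (Finset.sum_le_sum hrow)
    _ = _ := by rw [Finset.sum_const, nsmul_eq_mul]

/-- A family of words of the Reed-Muller code whose average has large `L¹` norm is small. -/
theorem card_le_of_mean_abs_avgFun_ge (hm : 0 < m) {ε : ℝ} (hε : 0 < ε) (hε1 : ε ≤ 1)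
    (s : Finset (reedMuller (r + 1) m)) (hs : s.Nonempty)
    (h : ε / 2 ≤ (∑ x, |avgFun signFun s x|) / Fintype.card (Fin m → ZMod 2)) :
    (s.card : ℝ) ≤ (2 ^ (r + 17) / ε ^ 6) ^ (2 ^ r * m ^ r) := by
  classical
  set N : ℝ := (Fintype.card (Fin m → ZMod 2) : ℝ) with hNdef
  have hN : 0 < N := by rw [hNdef]; exact_mod_cast Fintype.card_pos
  -- By Cauchy-Schwarz the mean square is at least `ε² / 4`; the threshold `ε² / 8` leaves half of
  -- it for the biased differences.
  have h1 := card_mul_sum_sq_avgFun_le s hs (ε ^ 2 / 8) (by positivity)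
  set A := Finset.univ.filter fun f : reedMuller (r + 1) m =>
        ε ^ 2 / 8 * Fintype.card (Fin m → ZMod 2) ≤ ∑ x, sgn (f.1 x) with hA
  rw [← hNdef] at h1
  have hA' := card_biased_le_pow hm (ε := ε ^ 2 / 8) (by positivity) (by nlinarith) A
    fun f hf => (Finset.mem_filter.1 hf).2
  have hcs := sq_sum_le_card_mul_sum_sq (s := Finset.univ) (f := fun x => |avgFun signFun s x|)
  simp only [sq_abs, Finset.card_univ] at hcs
  rw [← hNdef] at hcs
  rw [le_div_iff₀ hN] at h
  have h2 : (ε / 2 * N) ^ 2 ≤ N * ∑ x, avgFun signFun s x ^ 2 :=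
    (pow_le_pow_left₀ (by positivity) h 2).trans hcs
  have hc : (0 : ℝ) < s.card := by exact_mod_cast hs.card_pos
  have h3 : (s.card : ℝ) * (ε / 2 * N) ^ 2 ≤ N ^ 2 * (s.card * (ε ^ 2 / 8) + A.card) := by
    calc _ ≤ (s.card : ℝ) * (N * ∑ x, avgFun signFun s x ^ 2) := by gcongr
      _ = N * (s.card * ∑ x, avgFun signFun s x ^ 2) := by ring
      _ ≤ N * (N * (s.card * (ε ^ 2 / 8) + A.card)) := by gcongr
      _ = _ := by ring
  have h4 : (s.card : ℝ) * (ε ^ 2 / 8) ≤ A.card := by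
    have hN2 : 0 < N ^ 2 := by positivity
    refine le_of_mul_le_mul_left ?_ hN2
    linarith
  have hE : 1 ≤ 2 ^ r * m ^ r := Nat.one_le_iff_ne_zero.2 (by positivity)
  have h8 : (1 : ℝ) ≤ 8 / ε ^ 2 := by
    rw [one_le_div (by positivity)]
    nlinarith
  calc (s.card : ℝ) ≤ 8 / ε ^ 2 * A.card := by
        rw [div_mul_eq_mul_div, le_div_iff₀ (by positivity)]
        linarith
    _ ≤ (8 / ε ^ 2) ^ (2 ^ r * m ^ r) * (2 ^ (r + 8) / (ε ^ 2 / 8) ^ 2) ^ (2 ^ r * m ^ r) := by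
        gcongr
        exact le_self_pow₀ h8 (by omega)
    _ = _ := by
        rw [← mul_pow]
        congr 1
        rw [pow_add, pow_add]
        field_simp
        norm_num

theorem hammingDist_eq_wt_sub {n : ℕ} (x y : Fin n → ZMod 2) : hammingDist x y = wt (x - y) := by
  classical
  rw [hammingDist, wt]
  congr 1
  ext i
  simp [sub_eq_zero]

theorem sum_sgn_mul_sgn_eq {n : ℕ} (x y : Fin n → ZMod 2) :
    ∑ i, sgn (y i) * sgn (x i) = n - 2 * hammingDist x y := by
  have := sum_sgn_eq (x - y)
  rw [Fintype.card_fin, ← hammingDist_eq_wt_sub] at this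
  rw [← this]
  refine Finset.sum_congr rfl fun i _ => ?_
  rw [Pi.sub_apply, sgn_sub, mul_comm]

theorem card_filter_sampledCode {n : ℕ} (C : Submodule (ZMod 2) ((Fin m → ZMod 2) → ZMod 2))
    (t : Fin n → (Fin m → ZMod 2)) (p : (Fin n → ZMod 2) → Prop) [DecidablePred p] [Fintype C] :
    ((sampledCode (C : Set ((Fin m → ZMod 2) → ZMod 2)) t).filter p).card =
      (Finset.univ.filter fun f : C => p (f.1 ∘ t)).card := by
  classical
  rw [sampledCode, Multiset.filter_map, Multiset.card_map]
  change (Finset.filter (p ∘ fun x => x ∘ t) (Set.toFinite (C : Set _)).toFinset).card = _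
  symm
  refine Finset.card_bij (fun f _ => f.1) ?_ (fun _ _ _ _ h => Subtype.ext h) ?_
  · intro f hf
    simpa using hf
  · intro f hf
    simp only [Finset.mem_filter, Set.Finite.mem_toFinset, SetLike.mem_coe] at hf
    exact ⟨⟨f, hf.1⟩, by simpa using hf.2, rfl⟩

/-- A sampled Reed-Muller code with good minimum distance and small deviations is list
decodable. -/
theorem isListDecodable_sampledCode {n K : ℕ} {ε d : ℝ} (hm : 0 < m) (hn : 0 < n) (hε : 0 < ε)
    (hε1 : ε < 1) (hK : 2 ^ (r + 17) ≤ (1 / (1 - d)) ^ K)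
    (t : Fin n → (Fin m → ZMod 2))
    (hdist : ∀ f : reedMuller (r + 1) m, f ≠ 0 → d * n < wt (f.1 ∘ t))
    (hdev : ∀ s : Finset (reedMuller (r + 1) m), s.Nonempty → ∑ i, |avgFun signFun s (t i)| <
      n * ((∑ x, |avgFun signFun s x|) / Fintype.card (Fin m → ZMod 2)) + n * ε / 2) :
    IsListDecodable (sampledCode (reedMuller (r + 1) m : Set ((Fin m → ZMod 2) → ZMod 2)) t)
      (1 / 2 * (1 - ε)) ((1 / ε) ^ ((K + 6) * 2 ^ r * m ^ r)) := by
  classical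
  intro w
  have hnR : (0 : ℝ) < n := by exact_mod_cast hn
  rw [card_filter_sampledCode]
  set s := Finset.univ.filter fun f : reedMuller (r + 1) m =>
    relDist (f.1 ∘ t) w ≤ 1 / 2 * (1 - ε) with hs
  suffices h : (s.card : ℝ) ≤ (1 / ε) ^ ((K + 6) * 2 ^ r * m ^ r) by convert! h
  have hmem : ∀ f ∈ s, (hammingDist (f.1 ∘ t) w : ℝ) ≤ 1 / 2 * (1 - ε) * n := by
    intro f hf
    have := (Finset.mem_filter.1 hf).2
    rwa [relDist, div_le_iff₀ hnR] at this
  have h1ε : 1 ≤ 1 / ε := by rw [one_le_div hε]; exact hε1.le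
  by_cases hcard : s.card ≤ 1
  · calc (s.card : ℝ) ≤ 1 := by exact_mod_cast hcard
      _ ≤ _ := one_le_pow₀ h1ε
  · obtain ⟨f, hf, g, hg, hfg⟩ := Finset.one_lt_card.1 (not_le.1 hcard)
    -- Two listed words are more than `d n` apart, but at most `(1 - ε) n` by the triangle
    -- inequality.
    have hεd : ε < 1 - d := by
      have h1 := hdist (f - g) (sub_ne_zero.2 hfg)
      have h2 : ((f - g : reedMuller (r + 1) m).1 ∘ t) = f.1 ∘ t - g.1 ∘ t := rfl
      rw [h2, ← hammingDist_eq_wt_sub] at h1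
      have h3 := hammingDist_triangle_right (f.1 ∘ t) (g.1 ∘ t) w
      have h3' : (hammingDist (f.1 ∘ t) (g.1 ∘ t) : ℝ) ≤
        hammingDist (f.1 ∘ t) w + hammingDist (g.1 ∘ t) w := by exact_mod_cast h3
      have h4 := hmem f hf
      have h5 := hmem g hg
      have h6 : d * n < (1 - ε) * n := by linarith
      linarith [lt_of_mul_lt_mul_right h6 hnR.le]
    have hne : s.Nonempty := ⟨f, hf⟩
    have hc : (0 : ℝ) < s.card := by exact_mod_cast hne.card_pos
    have hlow : n * ε ≤ ∑ i, |avgFun signFun s (t i)| := by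
      have h1 : ∑ i, sgn (w i) * avgFun signFun s (t i) ≤ ∑ i, |avgFun signFun s (t i)| := by
        refine Finset.sum_le_sum fun i _ => (le_abs_self _).trans ?_
        rw [abs_mul, abs_sgn, one_mul]
      refine le_trans ?_ h1
      have h2 : ∑ i, sgn (w i) * avgFun signFun s (t i) =
          (∑ f ∈ s, ∑ i, sgn (w i) * sgn ((f.1 ∘ t) i)) / s.card := by
        rw [Finset.sum_comm, Finset.sum_div]
        refine Finset.sum_congr rfl fun i _ => ?_
        rw [avgFun, ← Finset.mul_sum, mul_div_assoc]
        rfl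
      rw [h2, le_div_iff₀ hc, mul_comm, ← nsmul_eq_mul]
      refine Finset.card_nsmul_le_sum _ _ _ fun f hf => ?_
      rw [sum_sgn_mul_sgn_eq]
      linarith [hmem f hf]
    have hmean : ε / 2 ≤ (∑ x, |avgFun signFun s x|) / Fintype.card (Fin m → ZMod 2) := by
      have h1 := hdev s hne
      refine le_of_mul_le_mul_left ?_ hnR
      linarith
    refine (card_le_of_mean_abs_avgFun_ge hm hε hε1.le s hne hmean).trans ?_
    rw [mul_assoc (K + 6), pow_mul (1 / ε) (K + 6)]
    refine pow_le_pow_left₀ (by positivity) ?_ _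
    calc 2 ^ (r + 17) / ε ^ 6 = 2 ^ (r + 17) * (1 / ε) ^ 6 := by
          rw [one_div, inv_pow, div_eq_mul_inv]
      -- Since `1/ε > 1/(1 - d)`, the constant is absorbed by `K` extra powers.
      _ ≤ (1 / ε) ^ K * (1 / ε) ^ 6 := by
          gcongr
          refine hK.trans ?_
          exact pow_le_pow_left₀ (one_div_nonneg.2 (by linarith))
            (one_div_le_one_div_of_le hε hεd.le) K
      _ = _ := (pow_add _ _ _).symm

end SampledCode

/-! ### The failure probability -/

section Probability

variable {r m : ℕ}

/-- The failure probability in the sampling theorem. -/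
noncomputable def failureBound (r m : ℕ) : ℝ :=
  2 ^ (1 + (m + 1) ^ r * (r + 8)) *
      Real.exp (-(8 * Module.finrank (ZMod 2) (reedMuller (r + 1) m) / 2 ^ r)) +
    2 * Real.exp (-(Module.finrank (ZMod 2) (reedMuller (r + 1) m) : ℝ))

theorem exists_mul_pow_le_finrank (r : ℕ) : ∃ a : ℝ, 0 < a ∧ ∀ᶠ m : ℕ in atTop,
    a * (m : ℝ) ^ r ≤ Module.finrank (ZMod 2) (reedMuller r m) := by
  refine ⟨1 / (2 ^ r * r.factorial), by positivity, ?_⟩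
  filter_upwards [eventually_ge_atTop (2 * r)] with m hm
  have h1 : (((m + 1 - r : ℕ) : ℝ)) ^ r / r.factorial ≤ m.choose r := Nat.pow_le_choose r m
  have h2 : (m : ℝ) / 2 ≤ ((m + 1 - r : ℕ) : ℝ) := by
    rw [div_le_iff₀ two_pos]
    have : m ≤ (m + 1 - r) * 2 := by omega
    exact_mod_cast this
  have h3 : ((m : ℝ) / 2) ^ r ≤ ((m + 1 - r : ℕ) : ℝ) ^ r := pow_le_pow_left₀ (by positivity) h2 r
  have h4 : (m.choose r : ℝ) ≤ Module.finrank (ZMod 2) (reedMuller r m) := by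
    exact_mod_cast choose_le_finrank_reedMuller r m
  calc 1 / (2 ^ r * r.factorial) * (m : ℝ) ^ r = ((m : ℝ) / 2) ^ r / r.factorial := by
        rw [div_pow]; field_simp
    _ ≤ m.choose r := by
        refine le_trans ?_ h1
        gcongr
    _ ≤ _ := h4

/-- The number of low-weight words has exponent of order `m^r`, whereas the dimension of the code of
degree `r + 1` grows at least like `m^(r+1)`. -/
theorem tendsto_failureBound (r : ℕ) : Tendsto (failureBound r) atTop (𝓝 0) := by
  obtain ⟨a, ha, hk⟩ := exists_mul_pow_le_finrank (r + 1)
  have hlin : ∀ C b : ℝ, 0 < b → Tendsto (fun m : ℕ => C - b * m) atTop atBot := by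
    intro C b hb
    have := (tendsto_natCast_atTop_atTop (R := ℝ)).const_mul_atTop hb
    simpa [sub_eq_add_neg] using tendsto_atBot_add_const_left _ C (tendsto_neg_atTop_atBot.comp this)
  set C : ℝ := 2 ^ r * (r + 9) with hC
  set b : ℝ := 8 * a / 2 ^ r with hb
  have hbpos : 0 < b := by positivity
  have hbound : ∀ᶠ m : ℕ in atTop,
      failureBound r m ≤ Real.exp (C - b * m) + 2 * Real.exp (0 - a * m) := by
    filter_upwards [hk, eventually_ge_atTop 1, (hlin C b hbpos).eventually_le_atBot 0]
      with m hkm hm1 hneg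
    have hm1' : (1 : ℝ) ≤ m := by exact_mod_cast hm1
    have hmr : (1 : ℝ) ≤ (m : ℝ) ^ r := one_le_pow₀ hm1'
    refine add_le_add ?_ (mul_le_mul_of_nonneg_left (Real.exp_le_exp.2 ?_) zero_le_two)
    · have hE : ((1 + (m + 1) ^ r * (r + 8) : ℕ) : ℝ) ≤ m ^ r * C := by
        have h1 : (m + 1) ^ r ≤ (2 * m) ^ r := Nat.pow_le_pow_left (by omega) r
        have h2 : 1 ≤ (2 * m) ^ r := Nat.one_le_pow _ _ (by omega)
        have h3 : 1 + (m + 1) ^ r * (r + 8) ≤ (2 * m) ^ r * (r + 9) := by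
          have := Nat.mul_le_mul_right (r + 8) h1
          have e : (2 * m) ^ r * (r + 9) = (2 * m) ^ r * (r + 8) + (2 * m) ^ r := by ring
          omega
        calc ((1 + (m + 1) ^ r * (r + 8) : ℕ) : ℝ) ≤ (((2 * m) ^ r * (r + 9) : ℕ) : ℝ) := by
              exact_mod_cast h3
          _ = _ := by rw [hC]; push_cast; rw [mul_pow]; ring
      have h2e : (2 : ℝ) ≤ Real.exp 1 := by linarith [Real.exp_one_gt_d9]
      calc _ ≤ Real.exp 1 ^ (1 + (m + 1) ^ r * (r + 8)) *
            Real.exp (-(8 * Module.finrank (ZMod 2) (reedMuller (r + 1) m) / 2 ^ r)) := by gcongr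
        _ = Real.exp (((1 + (m + 1) ^ r * (r + 8) : ℕ) : ℝ) +
            -(8 * Module.finrank (ZMod 2) (reedMuller (r + 1) m) / 2 ^ r)) := by
            rw [Real.exp_add, Real.exp_one_pow]
        _ ≤ Real.exp (C - b * m) := by
            apply Real.exp_le_exp.2
            have h5 : b * m * m ^ r ≤
                8 * Module.finrank (ZMod 2) (reedMuller (r + 1) m) / 2 ^ r := by
              calc b * m * m ^ r = 8 * (a * m ^ (r + 1)) / 2 ^ r := by rw [hb]; ring
                _ ≤ _ := by gcongr
            -- The exponent is at most `m^r (C - b m)`, and `m^r` may be dropped because `C - b m ≤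
            -- 0`.
            nlinarith
    · have h6 : a * m ≤ a * (m : ℝ) ^ (r + 1) := by
        gcongr
        exact le_self_pow₀ hm1' (by omega)
      linarith
  have hlim : Tendsto (fun m : ℕ => Real.exp (C - b * m) + 2 * Real.exp (0 - a * m)) atTop (𝓝 0) := by
    have h1 := Real.tendsto_exp_atBot.comp (hlin C b hbpos)
    have h2 := (Real.tendsto_exp_atBot.comp (hlin 0 a ha)).const_mul 2
    simpa using h1.add h2
  refine tendsto_of_tendsto_of_tendsto_of_le_of_le' tendsto_const_nhds hlim
    (Eventually.of_forall fun m => ?_) hbound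
  rw [failureBound]
  positivity

theorem natCast_two_pow_le_exp (k : ℕ) : (2 : ℝ) ^ k ≤ Real.exp k := by
  rw [← Real.exp_one_pow]
  exact pow_le_pow_left₀ zero_le_two (by linarith [Real.exp_one_gt_d9]) k

/-- With high probability, sampling keeps a constant fraction of the minimum distance. -/
theorem card_small_wt_le {n : ℕ} (hn : 64 * (Module.finrank (ZMod 2) (reedMuller (r + 1) m) : ℝ) ≤ n)
    (B : Finset (Fin n → (Fin m → ZMod 2)))
    (hB : ∀ t ∈ B, ∃ f : reedMuller (r + 1) m, f ≠ 0 ∧ (wt (f.1 ∘ t) : ℝ) ≤ 1 / 2 ^ (r + 4) * n) :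
    (B.card : ℝ) ≤ (Fintype.card (Fin m → ZMod 2) : ℝ) ^ n *
      (2 ^ (1 + (m + 1) ^ r * (r + 8)) *
        Real.exp (-(8 * Module.finrank (ZMod 2) (reedMuller (r + 1) m) / 2 ^ r)) +
      Real.exp (-(Module.finrank (ZMod 2) (reedMuller (r + 1) m) : ℝ))) := by
  classical
  set k := Module.finrank (ZMod 2) (reedMuller (r + 1) m) with hk
  set N : ℝ := (Fintype.card (Fin m → ZMod 2) : ℝ) with hNdef
  have hN : 0 < N := by rw [hNdef]; exact_mod_cast Fintype.card_pos
  set d : ℝ := 1 / 2 ^ (r + 4) with hd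
  -- Union bound in two ranges. Words in `A` have weight at most a quarter of the length: they are
  -- few, and the minimum distance suffices. The others are heavy enough for a union bound over the
  -- whole code.
  set A := Finset.univ.filter fun f : reedMuller (r + 1) m =>
    1 / 2 * N ≤ ∑ x, sgn (f.1 x) with hA
  let S : reedMuller (r + 1) m → Finset (Fin n → (Fin m → ZMod 2)) := fun f =>
    Finset.univ.filter fun t => (wt (f.1 ∘ t) : ℝ) ≤ d * n
  have hS : ∀ f, ((S f).card : ℝ) ≤ N ^ n * Real.exp (n * (d - wt f.1 / (2 * N))) := fun f =>
    card_wt_comp_le f.1 d (S f) fun t ht => (Finset.mem_filter.1 ht).2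
  have hd1 : d ≤ 1 / 16 := by
    rw [hd]
    refine one_div_le_one_div_of_le (by norm_num) ?_
    calc (16 : ℝ) = 2 ^ 4 := by norm_num
      _ ≤ 2 ^ (r + 4) := pow_le_pow_right₀ one_le_two (by omega)
  have hdpos : 0 < d := by positivity
  have hkA : (A.card : ℝ) ≤ 2 ^ (1 + (m + 1) ^ r * (r + 8)) := by
    have h1 := card_biased_le (r := r) (l := r + 7) (ε := 1 / 2) (by norm_num)
      (le_of_eq (by rw [pow_add, pow_add]; norm_num; ring)) A fun f hf => (Finset.mem_filter.1 hf).2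
    have h2 : A.card ≤ 2 ^ (1 + (m + 1) ^ r * (r + 8)) := by
      rw [natCard_reedMuller, ← pow_mul, ← pow_succ'] at h1
      refine h1.trans (Nat.pow_le_pow_right two_pos ?_)
      have := Nat.mul_le_mul_right (r + 8) (finrank_reedMuller_le r m)
      linarith
    exact_mod_cast h2
  have hsub : B ⊆ ((A.erase 0).biUnion S) ∪ ((Finset.univ.filter fun f => f ∉ A).biUnion S) := by
    intro t ht
    obtain ⟨f, hf0, hf⟩ := hB t ht
    have hfS : t ∈ S f := Finset.mem_filter.2 ⟨Finset.mem_univ _, hf⟩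
    rw [Finset.mem_union, Finset.mem_biUnion, Finset.mem_biUnion]
    by_cases hfA : f ∈ A
    · exact Or.inl ⟨f, Finset.mem_erase.2 ⟨hf0, hfA⟩, hfS⟩
    · exact Or.inr ⟨f, Finset.mem_filter.2 ⟨Finset.mem_univ _, hfA⟩, hfS⟩
  have hlow : (((A.erase 0).biUnion S).card : ℝ) ≤ N ^ n *
      (2 ^ (1 + (m + 1) ^ r * (r + 8)) * Real.exp (-(8 * k / 2 ^ r))) := by
    have h1 : ∀ f ∈ A.erase 0, ((S f).card : ℝ) ≤ N ^ n * Real.exp (-(8 * k / 2 ^ r)) := by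
      intro f hf
      refine (hS f).trans ?_
      gcongr
      have h2 := card_le_two_pow_mul_wt (r + 1) f.2 fun h => (Finset.ne_of_mem_erase hf)
        (Subtype.ext h)
      have h2' : N ≤ 2 ^ (r + 1) * wt f.1 := by rw [hNdef]; exact_mod_cast h2
      -- Here `d` is a quarter of the rate coming from the minimum distance, so the exponent is at
      -- most `-3 d n`.
      have h3 : 4 * d ≤ wt f.1 / (2 * N) := by
        rw [le_div_iff₀ (by positivity)]
        have e : 4 * d * (2 * N) = N / 2 ^ (r + 1) := by
          rw [hd, pow_add, pow_add]
          field_simp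
          norm_num
        rw [e, div_le_iff₀ (by positivity)]
        linarith
      have h4 : 8 * (k : ℝ) / 2 ^ r = 2 * d * (64 * k) := by
        rw [hd, pow_add]
        field_simp
        ring
      rw [h4]
      have h5 : 2 * d * (64 * k) ≤ 2 * d * n := by gcongr
      have h6 : (n : ℝ) * (d - wt f.1 / (2 * N)) ≤ n * (-(3 * d)) := by
        gcongr
        linarith
      nlinarith [mul_nonneg hdpos.le (Nat.cast_nonneg (α := ℝ) n)]
    calc (((A.erase 0).biUnion S).card : ℝ) ≤ ∑ f ∈ A.erase 0, ((S f).card : ℝ) := by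
          exact_mod_cast Finset.card_biUnion_le
      _ ≤ (A.erase 0).card • (N ^ n * Real.exp (-(8 * k / 2 ^ r))) := Finset.sum_le_card_nsmul _ _ _ h1
      _ ≤ 2 ^ (1 + (m + 1) ^ r * (r + 8)) * (N ^ n * Real.exp (-(8 * k / 2 ^ r))) := by
          rw [nsmul_eq_mul]
          gcongr
          exact le_trans (Nat.cast_le.2 (Finset.card_erase_le)) hkA
      _ = _ := by ring
  have hhigh : (((Finset.univ.filter fun f => f ∉ A).biUnion S).card : ℝ) ≤
      N ^ n * Real.exp (-(k : ℝ)) := by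
    have h1 : ∀ f ∈ Finset.univ.filter fun f => f ∉ A,
        ((S f).card : ℝ) ≤ N ^ n * Real.exp (-(4 * k)) := by
      intro f hf
      refine (hS f).trans ?_
      gcongr
      have h2 := (Finset.mem_filter.1 hf).2
      rw [hA, Finset.mem_filter] at h2
      push Not at h2
      have h3 := h2 (Finset.mem_univ _)
      rw [sum_sgn_eq, ← hNdef] at h3
      have h4 : 1 / 8 ≤ wt f.1 / (2 * N) := by
        rw [le_div_iff₀ (by positivity)]
        linarith
      have h5 : (n : ℝ) * (d - wt f.1 / (2 * N)) ≤ n * (-(1 / 16)) := by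
        gcongr
        linarith
      linarith
    calc (((Finset.univ.filter fun f => f ∉ A).biUnion S).card : ℝ)
        ≤ ∑ f ∈ Finset.univ.filter fun f => f ∉ A, ((S f).card : ℝ) := by
          exact_mod_cast Finset.card_biUnion_le
      _ ≤ (Finset.univ.filter fun f => f ∉ A).card • (N ^ n * Real.exp (-(4 * k))) :=
          Finset.sum_le_card_nsmul _ _ _ h1
      _ ≤ Real.exp k * (N ^ n * Real.exp (-(4 * k))) := by
          rw [nsmul_eq_mul]
          gcongr
          refine le_trans ?_ (natCast_two_pow_le_exp k)
          have h6 : (Finset.univ.filter fun f => f ∉ A).card ≤ 2 ^ k := by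
            rw [← natCard_reedMuller, Nat.card_eq_fintype_card]
            exact Finset.card_le_univ _
          exact_mod_cast h6
      _ = N ^ n * Real.exp (k + -(4 * k)) := by rw [Real.exp_add]; ring
      _ ≤ _ := by
          gcongr
          linarith [Nat.cast_nonneg (α := ℝ) k]
  calc (B.card : ℝ) ≤ (((A.erase 0).biUnion S).card : ℝ) +
        (((Finset.univ.filter fun f => f ∉ A).biUnion S).card : ℝ) := by
        exact_mod_cast (Finset.card_le_card hsub).trans (Finset.card_union_le _ _)
    _ ≤ _ := by
        rw [mul_add]
        exact add_le_add hlow hhigh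

theorem one_sub_le_uniformProb {Ω : Type*} [Fintype Ω] [Nonempty Ω] {p : Ω → Prop} {δ : ℝ}
    (B : Finset Ω) (hB : ∀ ω, ¬ p ω → ω ∈ B) (h : (B.card : ℝ) ≤ Fintype.card Ω * δ) :
    1 - δ ≤ uniformProb p := by
  classical
  have hΩ : (0 : ℝ) < Fintype.card Ω := by exact_mod_cast Fintype.card_pos
  rw [uniformProb, le_div_iff₀ hΩ]
  have h1 : Fintype.card Ω ≤ (Finset.univ.filter p).card + B.card := by
    rw [← Finset.card_univ]
    refine (Finset.card_le_card fun ω _ => ?_).trans (Finset.card_union_le _ _)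
    by_cases hp : p ω
    · simp [hp]
    · exact Finset.mem_union_right _ (hB ω hp)
  have h2 : (Fintype.card Ω : ℝ) ≤ (Finset.univ.filter p).card + B.card := by exact_mod_cast h1
  have h3 : (Fintype.card Ω : ℝ) - B.card ≤ (Finset.univ.filter p).card := by linarith
  refine le_trans (by linarith) (h3.trans (le_of_eq ?_))
  congr

/-- List decodability of sampled Reed-Muller codes, with an explicit failure probability. -/
theorem one_sub_failureBound_le {n K : ℕ} {ε : ℝ} (hm : 0 < m) (hn : 0 < n) (hε : 0 < ε)
    (hε1 : ε < 1) (hK : 2 ^ (r + 17) ≤ (1 / (1 - 1 / 2 ^ (r + 4) : ℝ)) ^ K)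
    (hrate : (Module.finrank (ZMod 2) (reedMuller (r + 1) m) : ℝ) / n ≤ 1 / 64 * ε ^ 2) :
    1 - failureBound r m ≤ uniformProb fun t : Fin n → (Fin m → ZMod 2) =>
      IsListDecodable (sampledCode (reedMuller (r + 1) m : Set ((Fin m → ZMod 2) → ZMod 2)) t)
        (1 / 2 * (1 - ε)) ((1 / ε) ^ ((K + 6) * 2 ^ r * m ^ r)) := by
  classical
  have hnR : (0 : ℝ) < n := by exact_mod_cast hn
  set k := Module.finrank (ZMod 2) (reedMuller (r + 1) m) with hk
  rw [div_le_iff₀ hnR] at hrate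
  let B₁ : Finset (Fin n → (Fin m → ZMod 2)) := Finset.univ.filter fun t =>
    ∃ s : Finset (reedMuller (r + 1) m), s.Nonempty ∧
      n * ((∑ x, |avgFun signFun s x|) / Fintype.card (Fin m → ZMod 2)) + n * ε / 2 ≤
        ∑ i, |avgFun signFun s (t i)|
  let B₂ : Finset (Fin n → (Fin m → ZMod 2)) := Finset.univ.filter fun t =>
    ∃ f : reedMuller (r + 1) m, f ≠ 0 ∧ (wt (f.1 ∘ t) : ℝ) ≤ 1 / 2 ^ (r + 4) * n
  have h1 := card_deviation_le (n := n) (signFun (r := r + 1) (m := m))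
    (fun f x => (abs_sgn _).le) hε.le B₁ fun t ht => (Finset.mem_filter.1 ht).2
  have hεn : ε ^ 2 * n ≤ n := mul_le_of_le_one_left hnR.le (pow_le_one₀ hε.le hε1.le)
  have h2 := card_small_wt_le (r := r) (m := m) (n := n) (by linarith) B₂
    fun t ht => (Finset.mem_filter.1 ht).2
  have h1' : (Fintype.card (reedMuller (r + 1) m) : ℝ) * Real.exp (-(ε ^ 2 * n / 32)) ≤
      Real.exp (-(k : ℝ)) := by
    rw [← Nat.card_eq_fintype_card, natCard_reedMuller]
    push_cast
    calc _ ≤ Real.exp k * Real.exp (-(2 * k)) := by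
          gcongr
          · exact natCast_two_pow_le_exp k
          · linarith
      _ = _ := by rw [← Real.exp_add]; congr 1; ring
  refine one_sub_le_uniformProb (B₁ ∪ B₂) (fun t ht => ?_) ?_
  · by_contra hcon
    rw [Finset.mem_union, not_or, Finset.mem_filter, Finset.mem_filter] at hcon
    push Not at hcon
    exact ht (isListDecodable_sampledCode hm hn hε hε1 hK t
      (fun f hf => hcon.2 (Finset.mem_univ _) f hf) fun s hs => hcon.1 (Finset.mem_univ _) s hs)
  · have h3 : ((B₁ ∪ B₂).card : ℝ) ≤ B₁.card + B₂.card := by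
      exact_mod_cast Finset.card_union_le B₁ B₂
    have h4 := h1.trans (mul_le_mul_of_nonneg_left h1' (by positivity))
    rw [Fintype.card_fun, Fintype.card_fin n]
    push_cast at h2 h4 ⊢
    refine (h3.trans (add_le_add h4 h2)).trans (le_of_eq ?_)
    rw [failureBound]
    ring

end Probability

/-! ### Choice of the constants. -/

theorem mainTheorem3 :
    ∃ c : ℝ, 0 < c ∧ ∀ r : ℕ, 1 ≤ r →
      ∃ (K : ℕ) (δ : ℕ → ℝ), Tendsto δ atTop (𝓝 0) ∧
        ∀ (m n : ℕ) (ε : ℝ), 0 < ε → ε < 1 → 0 < n →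
          (Module.finrank (ZMod 2) (reedMuller r m) : ℝ) / n ≤ c * ε ^ 2 →
          1 - δ m ≤ uniformProb fun t : Fin n → (Fin m → ZMod 2) =>
            IsListDecodable
              (sampledCode (reedMuller r m : Set ((Fin m → ZMod 2) → ZMod 2)) t)
              (1 / 2 * (1 - ε)) ((1 / ε) ^ (K * m ^ (r - 1))) := by
  -- With `c = 1/64` the deviation exponent `ε² n / 32` is at least `2k`, which beats the `2^k`
  -- codewords.
  refine ⟨1 / 64, by norm_num, fun r hr => ?_⟩
  obtain ⟨r, rfl⟩ := Nat.exists_eq_add_of_le' hr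
  have hd : (1 : ℝ) < 1 / (1 - 1 / 2 ^ (r + 4)) := by
    have h1 : (1 : ℝ) < 2 ^ (r + 4) := one_lt_pow₀ one_lt_two (by omega)
    have h2 : (1 : ℝ) / 2 ^ (r + 4) < 1 := by rwa [div_lt_one (by positivity)]
    have h3 : (0 : ℝ) < 1 / 2 ^ (r + 4) := by positivity
    rw [one_lt_div (by linarith)]
    linarith
  obtain ⟨K, hK⟩ := pow_unbounded_of_one_lt (2 ^ (r + 17)) hd
  -- The value 1 at `m = 0` makes that case trivial without affecting the limit.
  refine ⟨(K + 6) * 2 ^ r, fun m => if m = 0 then 1 else failureBound r m, ?_, ?_⟩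
  · refine (tendsto_failureBound r).congr' ?_
    filter_upwards [eventually_ne_atTop 0] with m hm
    rw [if_neg hm]
  · intro m n ε hε hε1 hn hrate
    rcases Nat.eq_zero_or_pos m with rfl | hm
    · simp only [if_true, sub_self]
      exact div_nonneg (Nat.cast_nonneg _) (Nat.cast_nonneg _)
    · simp only [if_neg hm.ne', Nat.add_sub_cancel]
      exact one_sub_failureBound_le hm hn hε hε1 hK.le hrate
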